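/- Let $(\bar M, g, F)$ be a locally product Riemannian manifold: a smooth Riemannian manifold with Levi-Civita connection $\bar\nabla$ and a smooth $(1,1)$-tensor field $F$ with $F^2 = I$, $F \neq \pm I$, $g(FX, FY) = g(X,Y)$ and $\bar\nabla F = 0$. Let $M$ be a Riemannian manifold isometrically immersed in $\bar M$ (its metric is also denoted by $g$), with Levi-Civita connection $\nabla$ and second fundamental form $\sigma$, so that $\sigma(X,Y)$ is the normal component of $\bar\nabla_X Y$. For $X$ tangent to $M$ write $FX = TX + \omega X$, where $TX$ is tangent and $\omega X$ is normal to $M$. Suppose that $M$ is a pointwise bi-slant submanifold, that is, there are orthogonal smooth distributions $D_1, D_2$ on $M$ with $TM = D_1 \oplus D_2$, $FD_1 \perp D_2$, $FD_2 \perp D_1$, and functions $\theta_1, \theta_2$ on $M$ (the slant functions) such that for $i = 1, 2$, every $p \in M$ and every non-zero $X \in (D_i)_p$, the angle between $FX$ and $(D_i)_p$ equals $\theta_i(p)$. Let $P_i$ be the orthogonal projection of $TM$ onto $D_i$ and $T_i = P_i \circ T$. Assume that $\theta_1$ and $\theta_2$ are distinct. Then: (i) for all smooth vector fields $X, Y$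 in $D_1$ and $Z$ in $D_2$, $$(\sin^2\theta_2 - \sin^2\theta_1)\, g(\nabla_X Y, Z) = g(\sigma(X,Z), \omega T_1 Y) + g(\sigma(X, T_2 Z), \omega Y) + g(\sigma(X,Y), \omega T_2 Z) + g(\sigma(X, T_1 Y), \omega Z);$$ (ii) for all smooth vector fields $Z, W$ in $D_2$ and $X$ in $D_1$, $$(\sin^2\theta_1 - \sin^2\theta_2)\, g(\nabla_Z W, X) = g(\sigma(X,Z), \omega T_2 W) + g(\sigma(Z, T_1 X), \omega W) + g(\sigma(Z,W), \omega T_1 X) + g(\sigma(Z, T_2 W), \omega X).$$ -/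

import Mathlib

open Bundle
open scoped Manifold ContDiff Topology

namespace BiSlant

noncomputable section

/-- The angle, in `[0, π/2]`, between a vector `v` and a subspace `W` of an inner product space:
the angle between `v` and its orthogonal projection to `W` (it is `π/2` if `v` is orthogonal
to `W`). -/
def angleWith {V : Type*} [NormedAddCommGroup V] [InnerProductSpace ℝ V]
    (v : V) (W : Submodule ℝ V) [W.HasOrthogonalProjection] : ℝ :=
  InnerProductGeometry.angle v (W.starProjection v)

section OneManifold

variable {E : Type*} [NormedAddCommGroup E] [NormedSpace ℝ E] [FiniteDimensional ℝ E]
  {M : Type*} [TopologicalSpace M] [ChartedSpace E M]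

instance instFiniteDimensionalTangentSpace (x : M) :
    FiniteDimensional ℝ (TangentSpace 𝓘(ℝ, E) x) :=
  inferInstanceAs (FiniteDimensional ℝ E)

/-- The vector field `X` is smooth. -/
def IsSmoothField (X : ∀ x : M, TangentSpace 𝓘(ℝ, E) x) [IsManifold 𝓘(ℝ, E) ∞ M] : Prop :=
  ContMDiff 𝓘(ℝ, E) 𝓘(ℝ, E).tangent ∞ (fun x ↦ (⟨x, X x⟩ : TangentBundle 𝓘(ℝ, E) M))

/-- A smooth distribution: near every point it has a frame of smooth vector fields. -/
def IsSmoothDistribution [IsManifold 𝓘(ℝ, E) ∞ M]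
    (D : ∀ x : M, Submodule ℝ (TangentSpace 𝓘(ℝ, E) x)) : Prop :=
  ∀ p : M, ∃ U ∈ 𝓝 p, ∃ (k : ℕ) (v : Fin k → ∀ x : M, TangentSpace 𝓘(ℝ, E) x),
    (∀ i, ContMDiffOn 𝓘(ℝ, E) 𝓘(ℝ, E).tangent ∞
      (fun x ↦ (⟨x, v i x⟩ : TangentBundle 𝓘(ℝ, E) M)) U) ∧
    ∀ x ∈ U, LinearIndependent ℝ (fun i ↦ v i x) ∧
      Submodule.span ℝ (Set.range fun i ↦ v i x) = D x

variable [IsManifold 𝓘(ℝ, E) ∞ M]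
  [RiemannianBundle (fun x : M ↦ TangentSpace 𝓘(ℝ, E) x)]
  [IsContMDiffRiemannianBundle 𝓘(ℝ, E) ∞ E (fun x : M ↦ TangentSpace 𝓘(ℝ, E) x)]

/-- `cov` is the Levi-Civita connection: it is torsion-free and compatible with the metric. -/
structure IsLeviCivita
    (cov : CovariantDerivative 𝓘(ℝ, E) E (fun x : M ↦ TangentSpace 𝓘(ℝ, E) x)) : Prop where
  torsion_eq_zero : cov.torsion = 0
  isMetricCompatible : CovariantDerivative.IsMetricCompatible
    (V := fun x : M ↦ TangentSpace 𝓘(ℝ, E) x) (F := E) cov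

/-- `F` is an almost product structure, compatible with the Riemannian metric: a smooth tensor
field of type (1,1) with `F² = I`, `F ≠ ± I` and `g(FX, FY) = g(X, Y)`. -/
structure IsAlmostProductRiemannian
    (F : ∀ x : M, TangentSpace 𝓘(ℝ, E) x →L[ℝ] TangentSpace 𝓘(ℝ, E) x) : Prop where
  smooth : ContMDiff 𝓘(ℝ, E) (𝓘(ℝ, E).prod 𝓘(ℝ, E →L[ℝ] E)) ∞
    (fun x ↦ TotalSpace.mk' (E →L[ℝ] E)
      (E := fun x : M ↦ TangentSpace 𝓘(ℝ, E) x →L[ℝ] TangentSpace 𝓘(ℝ, E) x) x (F x))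
  sq_eq : ∀ (x : M) (u : TangentSpace 𝓘(ℝ, E) x), F x (F x u) = u
  ne_id : F ≠ fun x ↦ ContinuousLinearMap.id ℝ (TangentSpace 𝓘(ℝ, E) x)
  ne_neg_id : F ≠ fun x ↦ -ContinuousLinearMap.id ℝ (TangentSpace 𝓘(ℝ, E) x)
  inner_map_map : ∀ (x : M) (u v : TangentSpace 𝓘(ℝ, E) x),
    inner ℝ (F x u) (F x v) = inner ℝ u v

/-- `(M, g, F)` with Levi-Civita connection `cov` is a locally product Riemannian manifold:
moreover `(∇_v F) Y = ∇_v (F Y) - F (∇_v Y) = 0` for tangent vectors `v` at `x` and vector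
fields `Y` that are smooth at `x`. -/
structure IsLocallyProductRiemannian
    (cov : CovariantDerivative 𝓘(ℝ, E) E (fun x : M ↦ TangentSpace 𝓘(ℝ, E) x))
    (F : ∀ x : M, TangentSpace 𝓘(ℝ, E) x →L[ℝ] TangentSpace 𝓘(ℝ, E) x) : Prop
    extends IsAlmostProductRiemannian F where
  isLeviCivita : IsLeviCivita cov
  parallel : ∀ (Y : ∀ x : M, TangentSpace 𝓘(ℝ, E) x) (x : M),
    ContMDiffAt 𝓘(ℝ, E) 𝓘(ℝ, E).tangent ∞
      (fun x ↦ (⟨x, Y x⟩ : TangentBundle 𝓘(ℝ, E) M)) x →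
    ∀ v : TangentSpace 𝓘(ℝ, E) x, cov (fun y ↦ F y (Y y)) x v - F x (cov Y x v) = 0

end OneManifold

section Submanifold

variable {E : Type*} [NormedAddCommGroup E] [NormedSpace ℝ E] [FiniteDimensional ℝ E]
  {M : Type*} [TopologicalSpace M] [ChartedSpace E M] [IsManifold 𝓘(ℝ, E) ∞ M]
  {E' : Type*} [NormedAddCommGroup E'] [NormedSpace ℝ E'] [FiniteDimensional ℝ E']
  {N : Type*} [TopologicalSpace N] [ChartedSpace E' N] [IsManifold 𝓘(ℝ, E') ∞ N]

/-- The covariant derivative `∇_v V` of a vector field `V` along a map `f : M → N` in the direction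
`v ∈ T_p M` (the pull-back connection). If `e₁, …, e_m` is the coordinate frame of `TN` near `f p`
and `V = ∑ Vⁱ (eᵢ ∘ f)`, then `∇_v V = ∑ (v(Vⁱ) eᵢ + Vⁱ(p) ∇_{df v} eᵢ)`. -/
def covAlong (cov : CovariantDerivative 𝓘(ℝ, E') E' (fun y : N ↦ TangentSpace 𝓘(ℝ, E') y))
    (f : M → N) (V : ∀ x : M, TangentSpace 𝓘(ℝ, E') (f x))
    (p : M) (v : TangentSpace 𝓘(ℝ, E) p) : TangentSpace 𝓘(ℝ, E') (f p) :=
  let e := trivializationAt E' (fun y : N ↦ TangentSpace 𝓘(ℝ, E') y) (f p)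
  let b := Module.finBasis ℝ E'
  ∑ i, (mvfderiv 𝓘(ℝ, E) (fun q ↦ e.localFrameCoeff 𝓘(ℝ, E') b i (f q) (V q)) p v •
        e.localFrame b i (f p) +
      e.localFrameCoeff 𝓘(ℝ, E') b i (f p) (V p) •
        cov (e.localFrame b i) (f p) (mfderiv 𝓘(ℝ, E) 𝓘(ℝ, E') f p v))

variable [RiemannianBundle (fun x : M ↦ TangentSpace 𝓘(ℝ, E) x)]
  [IsContMDiffRiemannianBundle 𝓘(ℝ, E) ∞ E (fun x : M ↦ TangentSpace 𝓘(ℝ, E) x)]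
  [RiemannianBundle (fun y : N ↦ TangentSpace 𝓘(ℝ, E') y)]
  [IsContMDiffRiemannianBundle 𝓘(ℝ, E') ∞ E' (fun y : N ↦ TangentSpace 𝓘(ℝ, E') y)]

/-- `f : M → N` is an isometric immersion: it is smooth and the metric of `M` is the one induced
by `f` (so that the differentials of `f` are injective). -/
structure IsIsometricImmersion (f : M → N) : Prop where
  contMDiff : ContMDiff 𝓘(ℝ, E) 𝓘(ℝ, E') ∞ f
  inner_mfderiv : ∀ (x : M) (u v : TangentSpace 𝓘(ℝ, E) x),
    inner ℝ (mfderiv 𝓘(ℝ, E) 𝓘(ℝ, E') f x u) (mfderiv 𝓘(ℝ, E) 𝓘(ℝ, E') f x v) = inner ℝ u v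

/-- The tangential component of `w ∈ T_{f x} N`, as a vector of `T_x M`. It is the image of `w`
under the adjoint of `df_x`; see `inner_normalPart_mfderiv`. -/
def tangentPart (f : M → N) (x : M) (w : TangentSpace 𝓘(ℝ, E') (f x)) : TangentSpace 𝓘(ℝ, E) x :=
  ContinuousLinearMap.adjoint (mfderiv 𝓘(ℝ, E) 𝓘(ℝ, E') f x) w

/-- The normal component of `w ∈ T_{f x} N`. -/
def normalPart (f : M → N) (x : M) (w : TangentSpace 𝓘(ℝ, E') (f x)) :
    TangentSpace 𝓘(ℝ, E') (f x) :=
  w - mfderiv 𝓘(ℝ, E) 𝓘(ℝ, E') f x (tangentPart (E := E) (E' := E') f x w)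

/-- `w = df (tangentPart w) + normalPart w` is the orthogonal decomposition of `w` with respect to
the image of `df_x`. -/
theorem inner_normalPart_mfderiv {f : M → N} (hf : IsIsometricImmersion (E := E) (E' := E') f) (x : M)
    (w : TangentSpace 𝓘(ℝ, E') (f x)) (u : TangentSpace 𝓘(ℝ, E) x) :
    inner ℝ (normalPart (E := E) (E' := E') f x w) (mfderiv 𝓘(ℝ, E) 𝓘(ℝ, E') f x u) = 0 := by
  rw [normalPart, inner_sub_left, hf.inner_mfderiv, tangentPart,
    ContinuousLinearMap.adjoint_inner_left, sub_self]

/-- The second fundamental form `σ(X, Y)`, the normal component of `∇_X Y`, where `∇` is the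
connection of the ambient manifold. -/
def secondFundamentalForm
    (cov : CovariantDerivative 𝓘(ℝ, E') E' (fun y : N ↦ TangentSpace 𝓘(ℝ, E') y))
    (f : M → N) (X Y : ∀ x : M, TangentSpace 𝓘(ℝ, E) x) (p : M) :
    TangentSpace 𝓘(ℝ, E') (f p) :=
  normalPart (E := E) f p
    (covAlong (E := E) cov f (fun x ↦ mfderiv 𝓘(ℝ, E) 𝓘(ℝ, E') f x (Y x)) p (X p))

variable (F : ∀ y : N, TangentSpace 𝓘(ℝ, E') y →L[ℝ] TangentSpace 𝓘(ℝ, E') y) (f : M → N)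

/-- `TX`, the tangential component of `FX`. -/
def tanF (x : M) (u : TangentSpace 𝓘(ℝ, E) x) : TangentSpace 𝓘(ℝ, E) x :=
  tangentPart (E' := E') f x (F (f x) (mfderiv 𝓘(ℝ, E) 𝓘(ℝ, E') f x u))

/-- `ωX`, the normal component of `FX`. -/
def norF (x : M) (u : TangentSpace 𝓘(ℝ, E) x) : TangentSpace 𝓘(ℝ, E') (f x) :=
  normalPart (E := E) f x (F (f x) (mfderiv 𝓘(ℝ, E) 𝓘(ℝ, E') f x u))

/-- `P ∘ T`, where `P` is the orthogonal projection to the distribution `D`. -/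
def projTanF (D : ∀ x : M, Submodule ℝ (TangentSpace 𝓘(ℝ, E) x)) (x : M)
    (u : TangentSpace 𝓘(ℝ, E) x) : TangentSpace 𝓘(ℝ, E) x :=
  (D x).starProjection (tanF F f x u)

/-- The distribution `D` on `M` is pointwise slant with slant function `θ`: at every point `x`,
the angle between `FX` and `D_x` is `θ x` for every non-zero `X ∈ D_x`. -/
def IsPointwiseSlant (D : ∀ x : M, Submodule ℝ (TangentSpace 𝓘(ℝ, E) x)) (θ : M → ℝ) : Prop :=
  ∀ (x : M), ∀ u ∈ D x, u ≠ 0 →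
    angleWith (F (f x) (mfderiv 𝓘(ℝ, E) 𝓘(ℝ, E') f x u))
      ((D x).map (mfderiv 𝓘(ℝ, E) 𝓘(ℝ, E') f x : TangentSpace 𝓘(ℝ, E) x →ₗ[ℝ] _)) = θ x

/-- The isometrically immersed manifold `M` is a pointwise bi-slant submanifold with respect to
the distributions `D₁`, `D₂` and the slant functions `θ₁`, `θ₂`. -/
structure IsPointwiseBiSlant (D₁ D₂ : ∀ x : M, Submodule ℝ (TangentSpace 𝓘(ℝ, E) x))
    (θ₁ θ₂ : M → ℝ) : Prop where
  isometric : IsIsometricImmersion (E := E) (E' := E') f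
  smooth₁ : IsSmoothDistribution D₁
  smooth₂ : IsSmoothDistribution D₂
  orthogonal : ∀ x, D₁ x ⟂ D₂ x
  sup_eq_top : ∀ x, D₁ x ⊔ D₂ x = ⊤
  map₁ : ∀ x, ∀ u ∈ D₁ x, ∀ v ∈ D₂ x,
    inner ℝ (F (f x) (mfderiv 𝓘(ℝ, E) 𝓘(ℝ, E') f x u)) (mfderiv 𝓘(ℝ, E) 𝓘(ℝ, E') f x v) = 0
  map₂ : ∀ x, ∀ u ∈ D₂ x, ∀ v ∈ D₁ x,
    inner ℝ (F (f x) (mfderiv 𝓘(ℝ, E) 𝓘(ℝ, E') f x u)) (mfderiv 𝓘(ℝ, E) 𝓘(ℝ, E') f x v) = 0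
  slant₁ : IsPointwiseSlant F f D₁ θ₁
  slant₂ : IsPointwiseSlant F f D₂ θ₂

end Submanifold

end

end BiSlant

/-!
Let `Y` and `Z` be tangent fields. The function `g(F Y, Z) = g(T Y, Z)` is differentiated along `X`
in two ways: in `N`, where `F` is parallel and symmetric, and in `M`. Comparing the two through the
Gauss formula gives
`g(∇_X T Y, Z) - g(∇_X Y, T Z) = g(σ(X, Z), ω Y) + g(σ(X, Y), ω Z)`.
The slant condition makes `T ^ 2` the scalar `cos ^ 2 θᵢ` on `Dᵢ`, and for `Y` in `D₁` and `Z` in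
`D₂` the term `g(∇_X T ^ 2 Y, Z) = -g(T ^ 2 Y, ∇_X Z)` contains no derivative of `θ₁`. Adding the
identity for `(T Y, Z)` to the one for `(Y, T Z)`, the terms `g(∇_X T Y, T Z)` cancel and
`(cos ^ 2 θ₁ - cos ^ 2 θ₂) g(∇_X Y, Z)` remains. The second part follows by exchanging the two
distributions.
-/

namespace BiSlant

noncomputable section

section LieBracket

variable {E : Type*} [NormedAddCommGroup E] [NormedSpace ℝ E]
  {G : Type*} [NormedAddCommGroup G] [NormedSpace ℝ G]
  {M : Type*} [TopologicalSpace M] [ChartedSpace E M]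
  {p : M} {X Y : ∀ x : M, TangentSpace 𝓘(ℝ, E) x}

/-- The vector field `X`, read in the preferred chart at `p`. -/
def chartField (p : M) (X : ∀ x : M, TangentSpace 𝓘(ℝ, E) x) : E → E :=
  VectorField.mpullbackWithin 𝓘(ℝ, E) 𝓘(ℝ, E) (extChartAt 𝓘(ℝ, E) p).symm X
    (Set.range 𝓘(ℝ, E))

theorem contDiffAt_comp_extChartAt_symm {n : ℕ∞ω} {h : M → G} (hh : CMDiffAt n h p) :
    ContDiffAt ℝ n (h ∘ (extChartAt 𝓘(ℝ, E) p).symm) (extChartAt 𝓘(ℝ, E) p p) := by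
  rw [← contDiffWithinAt_univ]
  simpa [Function.comp_def, chartAt_self_eq] using (contMDiffAt_iff.1 hh).2

theorem differentiableAt_chartField [IsManifold 𝓘(ℝ, E) 2 M] [CompleteSpace E]
    (hX : MDiffAt (T% X) p) :
    DifferentiableAt ℝ (chartField p X) (extChartAt 𝓘(ℝ, E) p p) := by
  have := (mdifferentiableWithinAt_univ.2 hX).differentiableWithinAt_mpullbackWithin_vectorField
  rw [← differentiableWithinAt_univ]
  simpa [chartField] using! this

theorem mvfderiv_apply_eq_fderiv_chartField [IsManifold 𝓘(ℝ, E) 1 M] {u : E}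
    (hu : u ∈ (extChartAt 𝓘(ℝ, E) p).target) {k : M → G}
    (hk : MDiffAt k ((extChartAt 𝓘(ℝ, E) p).symm u)) (X : ∀ x : M, TangentSpace 𝓘(ℝ, E) x) :
    d% k ((extChartAt 𝓘(ℝ, E) p).symm u) (X ((extChartAt 𝓘(ℝ, E) p).symm u)) =
      fderiv ℝ (k ∘ (extChartAt 𝓘(ℝ, E) p).symm) u (chartField p X u) := by
  have hinv := isInvertible_mfderivWithin_extChartAt_symm hu
  have hd := mdifferentiableWithinAt_extChartAt_symm hu
  simp only [modelWithCornersSelf_coe, Set.range_id, mfderivWithin_univ,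
    mdifferentiableWithinAt_univ] at hinv hd
  have hX : mfderiv 𝓘(ℝ, E) 𝓘(ℝ, E) (extChartAt 𝓘(ℝ, E) p).symm u (chartField (E := E) p X u) =
      X ((extChartAt 𝓘(ℝ, E) p).symm u) := by
    simp only [chartField, VectorField.mpullbackWithin_apply, modelWithCornersSelf_coe,
      Set.range_id, mfderivWithin_univ]
    exact hinv.self_apply_inverse _
  rw [← hX]
  refine (DFunLike.congr_fun (mfderiv_comp u hk hd) _).symm.trans ?_
  rw [mfderiv_eq_fderiv]
  rfl

theorem mvfderiv_apply_eq_fderiv_chartField_self [IsManifold 𝓘(ℝ, E) 1 M] {k : M → G}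
    (hk : MDiffAt k p) (X : ∀ x : M, TangentSpace 𝓘(ℝ, E) x) :
    d% k p (X p) = fderiv ℝ (k ∘ (extChartAt 𝓘(ℝ, E) p).symm)
      (extChartAt 𝓘(ℝ, E) p p) (chartField p X (extChartAt 𝓘(ℝ, E) p p)) := by
  have hp : (extChartAt 𝓘(ℝ, E) p).symm (extChartAt 𝓘(ℝ, E) p p) = p := extChartAt_to_inv p
  rw [← mvfderiv_apply_eq_fderiv_chartField (mem_extChartAt_target p) (by rwa [hp]) X]
  exact (congrArg (fun q ↦ d% k q (X q)) hp).symm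

theorem hasFDerivAt_mvfderiv_apply_comp_extChartAt_symm [IsManifold 𝓘(ℝ, E) 2 M] [CompleteSpace E]
    {h : M → G} (hh : CMDiffAt 2 h p) (hY : MDiffAt (T% Y) p) :
    HasFDerivAt ((fun q ↦ d% h q (Y q)) ∘ (extChartAt 𝓘(ℝ, E) p).symm)
      ((fderiv ℝ (h ∘ (extChartAt 𝓘(ℝ, E) p).symm) (extChartAt 𝓘(ℝ, E) p p)).comp
          (fderiv ℝ (chartField p Y) (extChartAt 𝓘(ℝ, E) p p)) +
        (fderiv ℝ (fderiv ℝ (h ∘ (extChartAt 𝓘(ℝ, E) p).symm))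
          (extChartAt 𝓘(ℝ, E) p p)).flip (chartField p Y (extChartAt 𝓘(ℝ, E) p p)))
      (extChartAt 𝓘(ℝ, E) p p) := by
  have hd : DifferentiableAt ℝ (fderiv ℝ (h ∘ (extChartAt 𝓘(ℝ, E) p).symm))
      (extChartAt 𝓘(ℝ, E) p p) :=
    ((contDiffAt_comp_extChartAt_symm hh).fderiv_right (m := 1) (by norm_num)).differentiableAt
      (by norm_num)
  refine (hd.hasFDerivAt.clm_apply
    (differentiableAt_chartField hY).hasFDerivAt).congr_of_eventuallyEq ?_
  have hev : ∀ᶠ q in 𝓝 p, MDiffAt h q := by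
    filter_upwards [(contMDiffAt_iff_contMDiffAt_nhds (by simp)).1 hh] with q hq
    exact hq.mdifferentiableAt (by simp)
  have hev' := (continuousAt_extChartAt_symm (I := 𝓘(ℝ, E)) p).eventually (by simpa using hev)
  filter_upwards [hev', extChartAt_target_mem_nhds (I := 𝓘(ℝ, E)) p] with u hu hu'
  exact mvfderiv_apply_eq_fderiv_chartField hu' hu Y

theorem mdifferentiableAt_mvfderiv_apply [IsManifold 𝓘(ℝ, E) 2 M] [CompleteSpace E]
    {h : M → G} (hh : CMDiffAt 2 h p) (hY : MDiffAt (T% Y) p) :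
    MDiffAt (fun q ↦ d% h q (Y q)) p :=
  mdifferentiableWithinAt_univ.1 <|
    (hasFDerivAt_mvfderiv_apply_comp_extChartAt_symm hh
      hY).differentiableAt.differentiableWithinAt.mdifferentiableWithinAt_of_comp_extChartAt_symm

theorem mlieBracket_eq_lieBracket_chartField [IsManifold 𝓘(ℝ, E) 1 M] (p : M)
    (X Y : ∀ x : M, TangentSpace 𝓘(ℝ, E) x) :
    VectorField.mlieBracket 𝓘(ℝ, E) X Y p =
      VectorField.lieBracket ℝ (chartField p X) (chartField p Y) (extChartAt 𝓘(ℝ, E) p p) := by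
  have hid (w : TangentSpace 𝓘(ℝ, E) (extChartAt 𝓘(ℝ, E) p p)) :
      (mfderiv 𝓘(ℝ, E) 𝓘(ℝ, E) (extChartAt 𝓘(ℝ, E) p) p).inverse w = w :=
    (isInvertible_mfderiv_extChartAt (mem_extChartAt_source p)).inverse_apply_eq.2
      (DFunLike.congr_fun (mfderiv_extChartAt_self (I := 𝓘(ℝ, E)) (x := p)) w).symm
  refine (hid _).trans ?_
  simp only [chartField, modelWithCornersSelf_coe, Set.range_id, Set.preimage_univ, Set.inter_univ]
  exact congrFun (VectorField.lieBracketWithin_univ (E := E)) _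

theorem mvfderiv_mlieBracket [IsManifold 𝓘(ℝ, E) 2 M] [CompleteSpace E] {h : M → G}
    (hh : CMDiffAt 2 h p) (hX : MDiffAt (T% X) p) (hY : MDiffAt (T% Y) p) :
    d% h p (VectorField.mlieBracket 𝓘(ℝ, E) X Y p) =
      d% (fun q ↦ d% h q (Y q)) p (X p) - d% (fun q ↦ d% h q (X q)) p (Y p) := by
  have hsymm : IsSymmSndFDerivAt ℝ (h ∘ (extChartAt 𝓘(ℝ, E) p).symm) (extChartAt 𝓘(ℝ, E) p p) :=
    (contDiffAt_comp_extChartAt_symm hh).isSymmSndFDerivAt (by simp)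
  have hbracket : d% h p (VectorField.mlieBracket 𝓘(ℝ, E) X Y p) =
      fderiv ℝ (h ∘ (extChartAt 𝓘(ℝ, E) p).symm) (extChartAt 𝓘(ℝ, E) p p)
        (VectorField.lieBracket ℝ (chartField p X) (chartField p Y)
          (extChartAt 𝓘(ℝ, E) p p)) := by
    rw [← mlieBracket_eq_lieBracket_chartField, (hh.mdifferentiableAt (by simp)).mvfderiv]
    simp only [modelWithCornersSelf_coe, Set.range_id, fderivWithin_univ]
    rfl
  rw [hbracket, mvfderiv_apply_eq_fderiv_chartField_self (mdifferentiableAt_mvfderiv_apply hh hY) X,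
    mvfderiv_apply_eq_fderiv_chartField_self (mdifferentiableAt_mvfderiv_apply hh hX) Y,
    (hasFDerivAt_mvfderiv_apply_comp_extChartAt_symm hh hY).fderiv,
    (hasFDerivAt_mvfderiv_apply_comp_extChartAt_symm hh hX).fderiv, VectorField.lieBracket]
  simp only [map_sub, _root_.add_apply, ContinuousLinearMap.comp_apply,
    ContinuousLinearMap.flip_apply]
  rw [hsymm.eq]
  abel

end LieBracket

section FiniteSums

variable {𝕜 : Type*} [NontriviallyNormedField 𝕜] {E : Type*} [NormedAddCommGroup E]
  [NormedSpace 𝕜 E] {H : Type*} [TopologicalSpace H] {I : ModelWithCorners 𝕜 E H}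
  {M : Type*} [TopologicalSpace M] [ChartedSpace H M] {p : M}

theorem mvfderiv_congr_of_eventuallyEq {G : Type*} [NormedAddCommGroup G] [NormedSpace 𝕜 G]
    {k k' : M → G} (h : k =ᶠ[𝓝 p] k') : mvfderiv I k p = mvfderiv I k' p := by
  ext v
  simp only [mvfderiv, h.mfderiv_eq]
  rfl

variable {ι : Type} (s : Finset ι) {a c : ι → M → 𝕜} (ha : ∀ i, MDiffAt (a i) p)
  (hc : ∀ i, MDiffAt (c i) p)
include ha hc

theorem mdifferentiableAt_sum_mul : MDiffAt (fun q ↦ ∑ i ∈ s, a i q * c i q) p := by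
  have := MDifferentiableAt.sum fun i (_ : i ∈ s) ↦ (ha i).mul (hc i)
  rwa [Finset.sum_fn] at this

theorem mvfderiv_sum_mul (v : TangentSpace I p) :
    mvfderiv I (fun q ↦ ∑ i ∈ s, a i q * c i q) p v =
      ∑ i ∈ s, (mvfderiv I (a i) p v * c i p + a i p * mvfderiv I (c i) p v) := by
  have hsum : mvfderiv I (fun q ↦ ∑ i ∈ s, a i q * c i q) p =
      ∑ i ∈ s, mvfderiv I (fun q ↦ a i q * c i q) p := by
    have := (HasMFDerivAt.sum fun i (_ : i ∈ s) ↦ ((ha i).mul (hc i)).hasMFDerivAt).mfderiv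
    rw [Finset.sum_fn] at this
    exact this
  rw [hsum, _root_.sum_apply]
  refine Finset.sum_congr rfl fun i _ ↦ ?_
  rw [mvfderiv_fun_mul (ha i) (hc i)]
  simp only [_root_.add_apply, _root_.smul_apply, smul_eq_mul]
  ring

omit ha hc

variable {F : Type*} [NormedAddCommGroup F] [NormedSpace 𝕜 F]
  {V : M → Type*} [TopologicalSpace (TotalSpace F V)] [∀ x, AddCommGroup (V x)]
  [∀ x, Module 𝕜 (V x)] [∀ x, TopologicalSpace (V x)] [FiberBundle F V] [VectorBundle 𝕜 F V]

theorem mdifferentiableAt_sum_smul_section {ι : Type*} (t : Finset ι) {a : ι → M → 𝕜}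
    {s : ι → ∀ x : M, V x} (ha : ∀ i, MDiffAt (a i) p) (hs : ∀ i, MDiffAt (T% (s i)) p) :
    MDiffAt (T% (fun y ↦ ∑ i ∈ t, a i y • s i y)) p :=
  MDifferentiableAt.sum_section fun i _ ↦ (ha i).smul_section (hs i)

theorem cov_sum_smul [∀ x, IsTopologicalAddGroup (V x)] [∀ x, ContinuousSMul 𝕜 (V x)]
    (cov : CovariantDerivative I F V) {ι : Type*} (t : Finset ι)
    {a : ι → M → 𝕜} {s : ι → ∀ x : M, V x} (ha : ∀ i, MDiffAt (a i) p)
    (hs : ∀ i, MDiffAt (T% (s i)) p) (w : TangentSpace I p) :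
    cov (fun y ↦ ∑ i ∈ t, a i y • s i y) p w =
      ∑ i ∈ t, (mvfderiv I (a i) p w • s i p + a i p • cov (s i) p w) := by
  classical
  induction t using Finset.induction_on with
  | empty =>
    simp only [Finset.sum_empty]
    exact DFunLike.congr_fun (congrFun cov.zero p) w
  | insert i t hi ih =>
    have hadd : cov (fun y ↦ a i y • s i y + ∑ i ∈ t, a i y • s i y) p =
        cov (a i • s i) p + cov (fun y ↦ ∑ i ∈ t, a i y • s i y) p :=
      cov.isCovariantDerivativeOn.add ((ha i).smul_section (hs i))
        (mdifferentiableAt_sum_smul_section t ha hs) (Set.mem_univ p)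
    simp only [Finset.sum_insert hi]
    rw [hadd, cov.isCovariantDerivativeOn.leibniz (hs i) (ha i) (Set.mem_univ p), ← ih]
    simp only [_root_.add_apply, _root_.smul_apply, ContinuousLinearMap.smulRight_apply]
    abel

end FiniteSums

section CoordinateFrame

variable {E : Type*} [NormedAddCommGroup E] [NormedSpace ℝ E] [FiniteDimensional ℝ E]
  {M : Type*} [TopologicalSpace M] [ChartedSpace E M]

/-- The `i`-th coordinate function of the preferred chart at `y₀`. -/
def coordFun (y₀ : M) (i : Fin (Module.finrank ℝ E)) (y : M) : ℝ :=
  (Module.finBasis ℝ E).coord i (extChartAt 𝓘(ℝ, E) y₀ y)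

variable [IsManifold 𝓘(ℝ, E) ∞ M]

theorem contMDiffAt_coordFun {y₀ y : M} (hy : y ∈ (chartAt E y₀).source)
    (i : Fin (Module.finrank ℝ E)) : CMDiffAt ∞ (coordFun y₀ i) y := by
  have hcoord : ContMDiff 𝓘(ℝ, E) 𝓘(ℝ, ℝ) ∞
      (LinearMap.toContinuousLinearMap ((Module.finBasis ℝ E).coord i)) :=
    (LinearMap.toContinuousLinearMap ((Module.finBasis ℝ E).coord i)).contMDiff
  have hchart : CMDiffAt ∞ (extChartAt 𝓘(ℝ, E) y₀) y := contMDiffAt_extChartAt' hy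
  exact hcoord.contMDiffAt.comp y hchart

/-- The `i`-th field `∂/∂xⁱ` of the coordinate frame of the tangent bundle near `y₀`. -/
def coordFrame (y₀ : M) (i : Fin (Module.finrank ℝ E)) (y : M) : TangentSpace 𝓘(ℝ, E) y :=
  (trivializationAt E (fun y : M ↦ TangentSpace 𝓘(ℝ, E) y) y₀).localFrame
    (Module.finBasis ℝ E) i y

/-- The coefficients of a tangent vector at `y` in the coordinate frame near `y₀`. -/
def coordCoeff (y₀ : M) (i : Fin (Module.finrank ℝ E)) (y : M) :
    TangentSpace 𝓘(ℝ, E) y →ₗ[ℝ] ℝ :=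
  (trivializationAt E (fun y : M ↦ TangentSpace 𝓘(ℝ, E) y) y₀).localFrameCoeff 𝓘(ℝ, E)
    (Module.finBasis ℝ E) i y

theorem contMDiffAt_coordFrame (y₀ : M) (i : Fin (Module.finrank ℝ E)) :
    CMDiffAt ∞ (T% (coordFrame y₀ i)) y₀ :=
  contMDiffAt_localFrame_of_mem (n := ∞) _ _ _ (FiberBundle.mem_baseSet_trivializationAt' y₀)

theorem mdifferentiableAt_coordFrame (y₀ : M) (i : Fin (Module.finrank ℝ E)) :
    MDiffAt (T% (coordFrame y₀ i)) y₀ :=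
  (contMDiffAt_coordFrame y₀ i).mdifferentiableAt (by simp)

theorem mdifferentiableAt_coordCoeff {y₀ : M} {s : ∀ y : M, TangentSpace 𝓘(ℝ, E) y}
    (hs : MDiffAt (T% s) y₀) (i : Fin (Module.finrank ℝ E)) :
    MDiffAt (fun y ↦ coordCoeff y₀ i y (s y)) y₀ :=
  mdifferentiableAt_localFrameCoeff (Module.finBasis ℝ E)
    (FiberBundle.mem_baseSet_trivializationAt' y₀) hs i

variable {y₀ y : M} (hy : y ∈ (chartAt E y₀).source)
include hy

theorem linearIndependent_coordFrame :
    LinearIndependent ℝ fun i : Fin (Module.finrank ℝ E) ↦ coordFrame y₀ i y :=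
  (Trivialization.isLocalFrameOn_localFrame_baseSet 𝓘(ℝ, E) 1
    (trivializationAt E (fun y : M ↦ TangentSpace 𝓘(ℝ, E) y) y₀)
    (Module.finBasis ℝ E)).linearIndependent hy

theorem sum_coordCoeff_smul_coordFrame (w : TangentSpace 𝓘(ℝ, E) y) :
    ∑ i, coordCoeff y₀ i y w • coordFrame y₀ i y = w := by
  classical
  have := Trivialization.eq_sum_localFrameCoeff_smul (I := 𝓘(ℝ, E))
    (e := trivializationAt E (fun y : M ↦ TangentSpace 𝓘(ℝ, E) y) y₀)
    (b := Module.finBasis ℝ E) (s := Function.update 0 y w) (x' := y) hy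
  simpa [coordFrame, coordCoeff] using! this.symm

theorem coordCoeff_coordFrame (i j : Fin (Module.finrank ℝ E)) :
    coordCoeff y₀ i y (coordFrame y₀ j y) = if j = i then 1 else 0 := by
  refine (Trivialization.localFrameCoeff_apply_of_mem_baseSet (I := 𝓘(ℝ, E)) _ _ hy
    (coordFrame y₀ j) i).trans ?_
  rw [coordFrame, Trivialization.localFrame_apply_of_mem_baseSet _ _ hy, Module.Basis.repr_self,
    Finsupp.single_apply]

theorem coordCoeff_eq_mvfderiv_coordFun (i : Fin (Module.finrank ℝ E))
    (w : TangentSpace 𝓘(ℝ, E) y) : coordCoeff y₀ i y w = d% (coordFun y₀ i) y w := by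
  classical
  set e := trivializationAt E (fun y : M ↦ TangentSpace 𝓘(ℝ, E) y) y₀
  have hcoeff := Trivialization.localFrameCoeff_eq_coeff (I := 𝓘(ℝ, E)) e
    (b := Module.finBasis ℝ E) (s := Function.update 0 y w) (x := y) hy (i := i)
  simp only [Function.update_self] at hcoeff
  have htriv : (e ⟨y, w⟩).2 = mfderiv 𝓘(ℝ, E) 𝓘(ℝ, E) (extChartAt 𝓘(ℝ, E) y₀) y w :=
    (congrFun (Trivialization.coe_linearMapAt_of_mem (R := ℝ) e hy) w).symm.trans
      (DFunLike.congr_fun (TangentBundle.continuousLinearMapAt_trivializationAt hy) w)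
  have hcomp := mvfderiv_comp_apply (I := 𝓘(ℝ, E)) (I' := 𝓘(ℝ, E)) y
    (g := LinearMap.toContinuousLinearMap ((Module.finBasis ℝ E).coord i))
    (ContinuousLinearMap.differentiableAt _).mdifferentiableAt
    (mdifferentiableAt_extChartAt (I := 𝓘(ℝ, E)) hy) w
  refine (hcoeff.trans ?_).trans hcomp.symm
  rw [mvfderiv, mfderiv_eq_fderiv, ContinuousLinearMap.fderiv]
  exact congrArg (fun z ↦ (Module.finBasis ℝ E).repr z i) htriv

omit hy

theorem mlieBracket_coordFrame (y₀ : M) (i j : Fin (Module.finrank ℝ E)) :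
    VectorField.mlieBracket 𝓘(ℝ, E) (coordFrame y₀ i) (coordFrame y₀ j) y₀ = 0 := by
  have hconst (j k : Fin (Module.finrank ℝ E)) :
      d% (fun q ↦ d% (coordFun y₀ k) q (coordFrame y₀ j q)) y₀ = 0 := by
    rw [mvfderiv_congr_of_eventuallyEq (k' := fun _ ↦ if j = k then 1 else 0), mvfderiv_const]
    filter_upwards [chart_source_mem_nhds E y₀] with y hy
    rw [← coordCoeff_eq_mvfderiv_coordFun hy, coordCoeff_coordFrame hy]
  rw [← sum_coordCoeff_smul_coordFrame (mem_chart_source E y₀)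
    (VectorField.mlieBracket 𝓘(ℝ, E) (coordFrame y₀ i) (coordFrame y₀ j) y₀)]
  refine Finset.sum_eq_zero fun k _ ↦ ?_
  rw [coordCoeff_eq_mvfderiv_coordFun (mem_chart_source E y₀),
    mvfderiv_mlieBracket ((contMDiffAt_coordFun (mem_chart_source E y₀) k).of_le (by norm_cast))
      (mdifferentiableAt_coordFrame y₀ i) (mdifferentiableAt_coordFrame y₀ j), hconst, hconst]
  simp

theorem cov_eq_sum_coordFrame
    (cov : CovariantDerivative 𝓘(ℝ, E) E (fun x : M ↦ TangentSpace 𝓘(ℝ, E) x))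
    {s : ∀ y : M, TangentSpace 𝓘(ℝ, E) y} (hs : MDiffAt (T% s) y₀)
    (w : TangentSpace 𝓘(ℝ, E) y₀) :
    cov s y₀ w = ∑ i, (d% (fun y ↦ coordCoeff y₀ i y (s y)) y₀ w • coordFrame y₀ i y₀ +
      coordCoeff y₀ i y₀ (s y₀) • cov (coordFrame y₀ i) y₀ w) := by
  rw [← cov_sum_smul cov Finset.univ (mdifferentiableAt_coordCoeff hs)
    (mdifferentiableAt_coordFrame y₀)]
  refine DFunLike.congr_fun (cov.isCovariantDerivativeOn.congr_of_eventuallyEq (s := Set.univ) hs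
    (mdifferentiableAt_sum_smul_section _ (mdifferentiableAt_coordCoeff hs)
      (mdifferentiableAt_coordFrame y₀)) Filter.univ_mem ?_) w
  filter_upwards [chart_source_mem_nhds E y₀] with y hy
  rw [sum_coordCoeff_smul_coordFrame hy]

end CoordinateFrame

section Along

variable {E : Type*} [NormedAddCommGroup E] [NormedSpace ℝ E]
  {M : Type*} [TopologicalSpace M] [ChartedSpace E M]
  {E' : Type*} [NormedAddCommGroup E'] [NormedSpace ℝ E'] [FiniteDimensional ℝ E']
  {N : Type*} [TopologicalSpace N] [ChartedSpace E' N] [IsManifold 𝓘(ℝ, E') ∞ N]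
  (cov : CovariantDerivative 𝓘(ℝ, E') E' (fun y : N ↦ TangentSpace 𝓘(ℝ, E') y))
  {f : M → N} {p : M}

/-- The vector field `V` along `f : M → N` is differentiable at `p`: its coefficients in the
coordinate frame of `TN` near `f p` are. -/
def DifferentiableAlongAt (E : Type*) [NormedAddCommGroup E] [NormedSpace ℝ E]
    {M : Type*} [TopologicalSpace M] [ChartedSpace E M]
    (f : M → N) (V : ∀ x : M, TangentSpace 𝓘(ℝ, E') (f x)) (p : M) : Prop :=
  ∀ i, MDifferentiableAt 𝓘(ℝ, E) 𝓘(ℝ, ℝ) (fun q ↦ coordCoeff (f p) i (f q) (V q)) p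

theorem eventually_eq_sum_coordCoeff_smul (hf : ContinuousAt f p)
    (V : ∀ x : M, TangentSpace 𝓘(ℝ, E') (f x)) :
    ∀ᶠ q in 𝓝 p,
      V q = ∑ i, coordCoeff (f p) i (f q) (V q) • coordFrame (f p) i (f q) := by
  filter_upwards [hf (chart_source_mem_nhds E' (f p))] with q hq
  rw [sum_coordCoeff_smul_coordFrame hq]

section Combination

variable {ι : Type} [Fintype ι] {V : ∀ x : M, TangentSpace 𝓘(ℝ, E') (f x)} {c : ι → M → ℝ}
  {s : ι → ∀ y : N, TangentSpace 𝓘(ℝ, E') y} (hf : MDiffAt f p) (hc : ∀ a, MDiffAt (c a) p)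
  (hs : ∀ a, MDiffAt (T% (s a)) (f p)) (hV : ∀ᶠ q in 𝓝 p, V q = ∑ a, c a q • s a (f q))
include hV

theorem eventuallyEq_coordCoeff_of_eventually_eq_sum (i : Fin (Module.finrank ℝ E')) :
    (fun q ↦ coordCoeff (f p) i (f q) (V q)) =ᶠ[𝓝 p]
      fun q ↦ ∑ a, c a q * ((fun y ↦ coordCoeff (f p) i y (s a y)) ∘ f) q := by
  filter_upwards [hV] with q hq
  simp [hq]

include hf hc hs

theorem differentiableAlongAt_of_eventually_eq_sum : DifferentiableAlongAt E f V p := fun i ↦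
  (mdifferentiableAt_sum_mul Finset.univ hc fun a ↦
    (mdifferentiableAt_coordCoeff (hs a) i).comp p hf).congr_of_eventuallyEq
      (eventuallyEq_coordCoeff_of_eventually_eq_sum hV i)

theorem covAlong_of_eventually_eq_sum (v : TangentSpace 𝓘(ℝ, E) p) :
    covAlong cov f V p v =
      ∑ a, (d% (c a) p v • s a (f p) + c a p • cov (s a) (f p) (mfderiv% f p v)) := by
  have hcomp (i a) : MDiffAt ((fun y ↦ coordCoeff (f p) i y (s a y)) ∘ f) p :=
    (mdifferentiableAt_coordCoeff (hs a) i).comp p hf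
  have hframe (a) : s a (f p) =
      ∑ i, coordCoeff (f p) i (f p) (s a (f p)) • coordFrame (f p) i (f p) :=
    (sum_coordCoeff_smul_coordFrame (mem_chart_source E' (f p)) _).symm
  conv_rhs =>
    enter [2, a]
    rw [hframe a, cov_eq_sum_coordFrame cov (hs a), Finset.smul_sum, Finset.smul_sum,
      ← Finset.sum_add_distrib]
  rw [Finset.sum_comm]
  refine Finset.sum_congr rfl fun i _ ↦ ?_
  change d% (fun q ↦ coordCoeff (f p) i (f q) (V q)) p v • coordFrame (f p) i (f p) +
    coordCoeff (f p) i (f p) (V p) • cov (coordFrame (f p) i) (f p) (mfderiv% f p v) = _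
  rw [mvfderiv_congr_of_eventuallyEq (eventuallyEq_coordCoeff_of_eventually_eq_sum hV i),
    mvfderiv_sum_mul Finset.univ hc (hcomp i), hV.self_of_nhds, map_sum, Finset.sum_smul,
    Finset.sum_smul, ← Finset.sum_add_distrib]
  refine Finset.sum_congr rfl fun a _ ↦ ?_
  rw [mvfderiv_comp_apply p (mdifferentiableAt_coordCoeff (hs a) i) hf]
  simp only [Function.comp_apply, map_smul, smul_eq_mul]
  module

end Combination

section Parallel

theorem mdifferentiableAt_map_coordFrame {y₀ : N}
    {F : ∀ y : N, TangentSpace 𝓘(ℝ, E') y →L[ℝ] TangentSpace 𝓘(ℝ, E') y}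
    (hF : MDifferentiableAt 𝓘(ℝ, E') (𝓘(ℝ, E').prod 𝓘(ℝ, E' →L[ℝ] E'))
      (fun y ↦ TotalSpace.mk' (E' →L[ℝ] E')
        (E := fun y : N ↦ TangentSpace 𝓘(ℝ, E') y →L[ℝ] TangentSpace 𝓘(ℝ, E') y) y (F y)) y₀)
    (i : Fin (Module.finrank ℝ E')) : MDiffAt (T% (fun y ↦ F y (coordFrame y₀ i y))) y₀ :=
  MDifferentiableAt.clm_bundle_apply (F₁ := E') (F₂ := E')
    (E₁ := fun y : N ↦ TangentSpace 𝓘(ℝ, E') y) (E₂ := fun y : N ↦ TangentSpace 𝓘(ℝ, E') y)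
    hF (mdifferentiableAt_coordFrame y₀ i)

theorem eventually_map_eq_sum_coordCoeff_smul (hf : ContinuousAt f p)
    (F : ∀ y : N, TangentSpace 𝓘(ℝ, E') y →L[ℝ] TangentSpace 𝓘(ℝ, E') y)
    (V : ∀ x : M, TangentSpace 𝓘(ℝ, E') (f x)) :
    ∀ᶠ q in 𝓝 p, F (f q) (V q) =
      ∑ i, coordCoeff (f p) i (f q) (V q) • F (f q) (coordFrame (f p) i (f q)) := by
  filter_upwards [eventually_eq_sum_coordCoeff_smul hf V] with q hq
  conv_lhs => rw [hq]
  simp only [map_sum, map_smul]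

variable {F : ∀ y : N, TangentSpace 𝓘(ℝ, E') y →L[ℝ] TangentSpace 𝓘(ℝ, E') y}
  (hf : MDiffAt f p)
  (hF : MDifferentiableAt 𝓘(ℝ, E') (𝓘(ℝ, E').prod 𝓘(ℝ, E' →L[ℝ] E'))
    (fun y ↦ TotalSpace.mk' (E' →L[ℝ] E')
      (E := fun y : N ↦ TangentSpace 𝓘(ℝ, E') y →L[ℝ] TangentSpace 𝓘(ℝ, E') y) y (F y)) (f p))
  {V : ∀ x : M, TangentSpace 𝓘(ℝ, E') (f x)} (hV : DifferentiableAlongAt E f V p)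
include hf hF hV

theorem DifferentiableAlongAt.map : DifferentiableAlongAt E f (fun q ↦ F (f q) (V q)) p :=
  differentiableAlongAt_of_eventually_eq_sum hf hV (mdifferentiableAt_map_coordFrame hF)
    (eventually_map_eq_sum_coordCoeff_smul hf.continuousAt F V)

theorem covAlong_map (hpar : ∀ Y : ∀ y : N, TangentSpace 𝓘(ℝ, E') y, CMDiffAt ∞ (T% Y) (f p) →
      ∀ w, cov (fun y ↦ F y (Y y)) (f p) w = F (f p) (cov Y (f p) w))
    (v : TangentSpace 𝓘(ℝ, E) p) :
    covAlong cov f (fun q ↦ F (f q) (V q)) p v = F (f p) (covAlong cov f V p v) := by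
  rw [covAlong_of_eventually_eq_sum cov hf hV (mdifferentiableAt_map_coordFrame hF)
      (eventually_map_eq_sum_coordCoeff_smul hf.continuousAt F V) v,
    covAlong_of_eventually_eq_sum cov hf hV (mdifferentiableAt_coordFrame (f p))
      (eventually_eq_sum_coordCoeff_smul hf.continuousAt V) v]
  simp only [map_sum, map_add, map_smul, hpar _ (contMDiffAt_coordFrame (f p) _)]

end Parallel

section Torsion

theorem coordCoeff_mfderiv {q : M} (hf : MDiffAt f q) {y₀ : N}
    (hq : f q ∈ (chartAt E' y₀).source) (i : Fin (Module.finrank ℝ E'))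
    (w : TangentSpace 𝓘(ℝ, E) q) :
    coordCoeff y₀ i (f q) (mfderiv% f q w) = d% (coordFun y₀ i ∘ f) q w := by
  rw [coordCoeff_eq_mvfderiv_coordFun hq]
  exact (mvfderiv_comp_apply q ((contMDiffAt_coordFun hq i).mdifferentiableAt (by simp)) hf w).symm

variable (hf : CMDiffAt 2 f p) {X Y : ∀ x : M, TangentSpace 𝓘(ℝ, E) x}
include hf

theorem contMDiffAt_coordFun_comp (i : Fin (Module.finrank ℝ E')) :
    CMDiffAt 2 (coordFun (f p) i ∘ f) p :=
  ((contMDiffAt_coordFun (mem_chart_source E' (f p)) i).of_le (by norm_cast)).comp p hf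

variable [IsManifold 𝓘(ℝ, E) 2 M]

theorem eventuallyEq_coordCoeff_mfderiv (Y : ∀ x : M, TangentSpace 𝓘(ℝ, E) x)
    (i : Fin (Module.finrank ℝ E')) :
    (fun q ↦ coordCoeff (f p) i (f q) (mfderiv% f q (Y q))) =ᶠ[𝓝 p]
      fun q ↦ d% (coordFun (f p) i ∘ f) q (Y q) := by
  filter_upwards [(contMDiffAt_iff_contMDiffAt_nhds (by simp)).1 hf,
    hf.continuousAt (chart_source_mem_nhds E' (f p))] with q hfq hq
  exact coordCoeff_mfderiv (hfq.mdifferentiableAt (by simp)) hq i (Y q)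

theorem differentiableAlongAt_mfderiv [CompleteSpace E] (hY : MDiffAt (T% Y) p) :
    DifferentiableAlongAt E f (fun q ↦ mfderiv% f q (Y q)) p := fun i ↦
  (mdifferentiableAt_mvfderiv_apply (contMDiffAt_coordFun_comp hf i) hY).congr_of_eventuallyEq
    (eventuallyEq_coordCoeff_mfderiv hf Y i)

theorem covAlong_mfderiv (Y : ∀ x : M, TangentSpace 𝓘(ℝ, E) x) (v : TangentSpace 𝓘(ℝ, E) p) :
    covAlong cov f (fun q ↦ mfderiv% f q (Y q)) p v =
      ∑ i, d% (fun q ↦ d% (coordFun (f p) i ∘ f) q (Y q)) p v • coordFrame (f p) i (f p) +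
      ∑ i, coordCoeff (f p) i (f p) (mfderiv% f p (Y p)) •
        cov (coordFrame (f p) i) (f p) (mfderiv% f p v) := by
  rw [← Finset.sum_add_distrib]
  refine Finset.sum_congr rfl fun i _ ↦ ?_
  rw [← mvfderiv_congr_of_eventuallyEq (eventuallyEq_coordCoeff_mfderiv hf Y i)]
  rfl

omit hf

theorem sum_coordCoeff_smul_cov_coordFrame_comm (htor : cov.torsion = 0) {y : N}
    (u w : TangentSpace 𝓘(ℝ, E') y) :
    ∑ i, coordCoeff y i y u • cov (coordFrame y i) y w =
      ∑ i, coordCoeff y i y w • cov (coordFrame y i) y u := by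
  have hframe (i j) : cov (coordFrame y i) y (coordFrame y j y) =
      cov (coordFrame y j) y (coordFrame y i y) := by
    have h := cov.torsion_eq_zero_iff.1 htor (mdifferentiableAt_coordFrame y j)
      (mdifferentiableAt_coordFrame y i)
    rwa [mlieBracket_coordFrame, sub_eq_zero] at h
  have hexpand (i) (w : TangentSpace 𝓘(ℝ, E') y) : cov (coordFrame y i) y w =
      ∑ j, coordCoeff y j y w • cov (coordFrame y i) y (coordFrame y j y) := by
    conv_lhs => rw [← sum_coordCoeff_smul_coordFrame (mem_chart_source E' y) w]
    simp only [map_sum, map_smul]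
  simp only [hexpand _ u, hexpand _ w, Finset.smul_sum]
  rw [Finset.sum_comm]
  refine Finset.sum_congr rfl fun i _ ↦ Finset.sum_congr rfl fun j _ ↦ ?_
  rw [hframe, smul_comm]

theorem covAlong_mfderiv_sub [CompleteSpace E] (htor : cov.torsion = 0) (hf : CMDiffAt 2 f p)
    (hX : MDiffAt (T% X) p) (hY : MDiffAt (T% Y) p) :
    covAlong cov f (fun q ↦ mfderiv% f q (Y q)) p (X p) -
      covAlong cov f (fun q ↦ mfderiv% f q (X q)) p (Y p) =
    mfderiv% f p (VectorField.mlieBracket 𝓘(ℝ, E) X Y p) := by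
  rw [covAlong_mfderiv cov hf, covAlong_mfderiv cov hf,
    sum_coordCoeff_smul_cov_coordFrame_comm cov htor, add_sub_add_right_eq_sub,
    ← Finset.sum_sub_distrib, ← sum_coordCoeff_smul_coordFrame (mem_chart_source E' (f p))
      (mfderiv% f p (VectorField.mlieBracket 𝓘(ℝ, E) X Y p))]
  refine Finset.sum_congr rfl fun i _ ↦ ?_
  rw [coordCoeff_mfderiv (hf.mdifferentiableAt (by simp)) (mem_chart_source E' (f p)),
    mvfderiv_mlieBracket (contMDiffAt_coordFun_comp hf i) hX hY, sub_smul]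

end Torsion

end Along

section MetricAlong

variable {E : Type*} [NormedAddCommGroup E] [NormedSpace ℝ E]
  {M : Type*} [TopologicalSpace M] [ChartedSpace E M]
  {E' : Type*} [NormedAddCommGroup E'] [NormedSpace ℝ E'] [FiniteDimensional ℝ E']
  {N : Type*} [TopologicalSpace N] [ChartedSpace E' N] [IsManifold 𝓘(ℝ, E') ∞ N]
  [RiemannianBundle (fun y : N ↦ TangentSpace 𝓘(ℝ, E') y)]

section InnerFrame

variable {f : M → N} {p : M} {V W : ∀ x : M, TangentSpace 𝓘(ℝ, E') (f x)}

theorem eventuallyEq_inner_sum_coordCoeff_mul (hf : ContinuousAt f p) :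
    (fun q ↦ inner ℝ (V q) (W q)) =ᶠ[𝓝 p] fun q ↦
      ∑ i, coordCoeff (f p) i (f q) (V q) * inner ℝ (coordFrame (f p) i (f q)) (W q) := by
  filter_upwards [eventually_eq_sum_coordCoeff_smul hf V] with q hq
  conv_lhs => rw [hq]
  simp only [sum_inner, real_inner_smul_left]

variable (hf : ContinuousAt f p) (hV : DifferentiableAlongAt E f V p)
  (hW : ∀ i, MDiffAt (fun q ↦ inner ℝ (coordFrame (f p) i (f q)) (W q)) p)
include hf hV hW

theorem mdifferentiableAt_inner_of_coordFrame : MDiffAt (fun q ↦ inner ℝ (V q) (W q)) p :=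
  (mdifferentiableAt_sum_mul Finset.univ hV hW).congr_of_eventuallyEq
    (eventuallyEq_inner_sum_coordCoeff_mul hf)

theorem mvfderiv_inner_of_coordFrame
    {cov : CovariantDerivative 𝓘(ℝ, E') E' (fun y : N ↦ TangentSpace 𝓘(ℝ, E') y)}
    {v : TangentSpace 𝓘(ℝ, E) p} {w : TangentSpace 𝓘(ℝ, E') (f p)}
    (hw : ∀ i, d% (fun q ↦ inner ℝ (coordFrame (f p) i (f q)) (W q)) p v =
      inner ℝ (cov (coordFrame (f p) i) (f p) (mfderiv% f p v)) (W p) +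
        inner ℝ (coordFrame (f p) i (f p)) w) :
    d% (fun q ↦ inner ℝ (V q) (W q)) p v =
      inner ℝ (covAlong cov f V p v) (W p) + inner ℝ (V p) w := by
  have hVp := (eventually_eq_sum_coordCoeff_smul hf V).self_of_nhds
  rw [mvfderiv_congr_of_eventuallyEq (eventuallyEq_inner_sum_coordCoeff_mul hf),
    mvfderiv_sum_mul Finset.univ hV hW, hVp, covAlong, sum_inner, sum_inner,
    ← Finset.sum_add_distrib]
  refine Finset.sum_congr rfl fun i _ ↦ ?_
  rw [hw, inner_add_left, real_inner_smul_left, real_inner_smul_left, real_inner_smul_left, ← hVp]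
  change _ = d% (fun q ↦ coordCoeff (f p) i (f q) (V q)) p v *
      inner ℝ (coordFrame (f p) i (f p)) (W p) +
    coordCoeff (f p) i (f p) (V p) *
      inner ℝ (cov (coordFrame (f p) i) (f p) (mfderiv% f p v)) (W p) + _
  ring

end InnerFrame

variable [IsContMDiffRiemannianBundle 𝓘(ℝ, E') ∞ E' (fun y : N ↦ TangentSpace 𝓘(ℝ, E') y)]

section InnerSections

variable {y₀ : N} {s t : ∀ y : N, TangentSpace 𝓘(ℝ, E') y}
  (hs : MDiffAt (T% s) y₀) (ht : MDiffAt (T% t) y₀)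
include hs ht

omit [FiniteDimensional ℝ E'] in
theorem mdifferentiableAt_inner : MDiffAt (fun y ↦ inner ℝ (s y) (t y)) y₀ :=
  MDifferentiableAt.inner_bundle (F := E') (E := fun y : N ↦ TangentSpace 𝓘(ℝ, E') y)
    (b := fun y ↦ y) hs ht

theorem IsLeviCivita.mvfderiv_inner
    {cov : CovariantDerivative 𝓘(ℝ, E') E' (fun y : N ↦ TangentSpace 𝓘(ℝ, E') y)}
    (hcov : IsLeviCivita cov) (w : TangentSpace 𝓘(ℝ, E') y₀) :
    d% (fun y ↦ inner ℝ (s y) (t y)) y₀ w =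
      inner ℝ (cov s y₀ w) (t y₀) + inner ℝ (s y₀) (cov t y₀ w) := by
  classical
  simpa using hcov.isMetricCompatible.mvfderiv_inner_eq (Function.update 0 y₀ w) hs ht

end InnerSections

variable {f : M → N} {p : M} {V W : ∀ x : M, TangentSpace 𝓘(ℝ, E') (f x)}
  (hf : MDiffAt f p) (hV : DifferentiableAlongAt E f V p) (hW : DifferentiableAlongAt E f W p)
include hf hV

section Composition

variable {s : ∀ y : N, TangentSpace 𝓘(ℝ, E') y} (hs : MDiffAt (T% s) (f p))
include hs

theorem mdifferentiableAt_inner_comp : MDiffAt (fun q ↦ inner ℝ (s (f q)) (V q)) p := by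
  simp only [real_inner_comm (V _)]
  exact mdifferentiableAt_inner_of_coordFrame hf.continuousAt hV fun i ↦
    (mdifferentiableAt_inner (mdifferentiableAt_coordFrame (f p) i) hs).comp p hf

theorem IsLeviCivita.mvfderiv_inner_comp
    {cov : CovariantDerivative 𝓘(ℝ, E') E' (fun y : N ↦ TangentSpace 𝓘(ℝ, E') y)}
    (hcov : IsLeviCivita cov) (v : TangentSpace 𝓘(ℝ, E) p) :
    d% (fun q ↦ inner ℝ (s (f q)) (V q)) p v =
      inner ℝ (cov s (f p) (mfderiv% f p v)) (V p) +
        inner ℝ (s (f p)) (covAlong cov f V p v) := by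
  have hframe (i) := mdifferentiableAt_inner (mdifferentiableAt_coordFrame (f p) i) hs
  simp only [real_inner_comm (V _)]
  rw [mvfderiv_inner_of_coordFrame (w := cov s (f p) (mfderiv% f p v)) (cov := cov)
    hf.continuousAt hV (fun i ↦ (hframe i).comp p hf), add_comm, real_inner_comm (s (f p))]
  intro i
  rw [← hcov.mvfderiv_inner (mdifferentiableAt_coordFrame (f p) i) hs]
  exact mvfderiv_comp_apply p (hframe i) hf v

end Composition

include hW

theorem mdifferentiableAt_inner_along : MDiffAt (fun q ↦ inner ℝ (V q) (W q)) p :=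
  mdifferentiableAt_inner_of_coordFrame hf.continuousAt hV fun i ↦
    mdifferentiableAt_inner_comp hf hW (mdifferentiableAt_coordFrame (f p) i)

theorem IsLeviCivita.mvfderiv_inner_along
    {cov : CovariantDerivative 𝓘(ℝ, E') E' (fun y : N ↦ TangentSpace 𝓘(ℝ, E') y)}
    (hcov : IsLeviCivita cov) (v : TangentSpace 𝓘(ℝ, E) p) :
    d% (fun q ↦ inner ℝ (V q) (W q)) p v =
      inner ℝ (covAlong cov f V p v) (W p) + inner ℝ (V p) (covAlong cov f W p v) :=
  have hframe (i) := mdifferentiableAt_coordFrame (f p) i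
  mvfderiv_inner_of_coordFrame hf.continuousAt hV
    (fun i ↦ mdifferentiableAt_inner_comp hf hW (hframe i))
    fun i ↦ hcov.mvfderiv_inner_comp hf hW (hframe i) v

end MetricAlong

section Gram

variable {E : Type*} [NormedAddCommGroup E] [NormedSpace ℝ E]
  {M : Type*} [TopologicalSpace M] [ChartedSpace E M] {p : M}

section LinearSystem

variable {ι : Type} [Fintype ι] [DecidableEq ι] {A : M → Matrix ι ι ℝ}
  (hA : ∀ i j, MDiffAt (fun q ↦ A q i j) p)
include hA

theorem mdifferentiableAt_det : MDiffAt (fun q ↦ (A q).det) p := by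
  have hdet : (fun q ↦ (A q).det) = ∑ σ : Equiv.Perm ι,
      (fun _ ↦ ((Equiv.Perm.sign σ : ℤ) : ℝ)) * ∏ i, fun q ↦ A q (σ i) i := by
    ext q
    simp [Matrix.det_apply']
  rw [hdet]
  exact .sum fun σ _ ↦ mdifferentiableAt_const.mul (.prod fun i _ ↦ hA (σ i) i)

theorem mdifferentiableAt_of_mulVec {c : M → ι → ℝ} (hdet : (A p).det ≠ 0)
    (hAc : ∀ i, MDiffAt (fun q ↦ (A q).mulVec (c q) i) p) (i : ι) :
    MDiffAt (fun q ↦ c q i) p := by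
  have hdetA := mdifferentiableAt_det hA
  have hcramer : MDiffAt (fun q ↦ (A q).cramer ((A q).mulVec (c q)) i) p :=
    mdifferentiableAt_det fun j k ↦ by
      rcases eq_or_ne k i with rfl | hk
      · simpa using hAc j
      · simpa [hk] using hA j k
  refine (hcramer.div hdetA hdet).congr_of_eventuallyEq ?_
  filter_upwards [hdetA.continuousAt.eventually_ne hdet] with q hq
  rw [Pi.div_apply, eq_div_iff hq, Matrix.cramer_eq_adjugate_mulVec, Matrix.mulVec_mulVec,
    Matrix.adjugate_mul, Matrix.smul_mulVec, Matrix.one_mulVec, Pi.smul_apply, smul_eq_mul,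
    mul_comm]

end LinearSystem

theorem mdifferentiableAt_of_inner_coordFrame [FiniteDimensional ℝ E] [IsManifold 𝓘(ℝ, E) ∞ M]
    [RiemannianBundle (fun x : M ↦ TangentSpace 𝓘(ℝ, E) x)]
    [IsContMDiffRiemannianBundle 𝓘(ℝ, E) ∞ E (fun x : M ↦ TangentSpace 𝓘(ℝ, E) x)]
    {s : ∀ x : M, TangentSpace 𝓘(ℝ, E) x}
    (hs : ∀ i, MDiffAt (fun x ↦ inner ℝ (coordFrame p i x) (s x)) p) : MDiffAt (T% s) p := by
  have hdet : (Matrix.gram ℝ (coordFrame (E := E) p · p)).det ≠ 0 := by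
    rw [Matrix.det_gram_ne_zero_iff_linearIndependent]
    exact linearIndependent_coordFrame (mem_chart_source E p)
  have hcoeff (i) : MDiffAt (fun x ↦ coordCoeff p i x (s x)) p := by
    refine mdifferentiableAt_of_mulVec (A := fun x ↦ Matrix.gram ℝ (coordFrame p · x))
      (c := fun x i ↦ coordCoeff p i x (s x))
      (fun i j ↦ mdifferentiableAt_inner (mdifferentiableAt_coordFrame p i)
        (mdifferentiableAt_coordFrame p j))
      hdet (fun i ↦ (hs i).congr_of_eventuallyEq ?_) i
    filter_upwards [chart_source_mem_nhds E p] with x hx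
    conv_rhs => rw [← sum_coordCoeff_smul_coordFrame hx (s x)]
    simp only [Matrix.mulVec, dotProduct, Matrix.gram_apply, inner_sum, real_inner_smul_right,
      mul_comm]
  exact (mdifferentiableAt_iff_localFrameCoeff (Module.finBasis ℝ E)
    (FiberBundle.mem_baseSet_trivializationAt' p)).2 hcoeff

end Gram

section SlantAlgebra

variable {V W : Type*} [NormedAddCommGroup V] [InnerProductSpace ℝ V]
  [NormedAddCommGroup W] [InnerProductSpace ℝ W]

theorem norm_starProjection_eq_cos_angleWith_mul_norm (K : Submodule ℝ V)
    [K.HasOrthogonalProjection] (v : V) :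
    ‖K.starProjection v‖ = Real.cos (angleWith v K) * ‖v‖ := by
  by_cases hv : K.starProjection v = 0
  · rw [angleWith, hv, InnerProductGeometry.angle_zero_right, Real.cos_pi_div_two, norm_zero,
      zero_mul]
  refine mul_right_cancel₀ (norm_ne_zero_iff.2 hv) ?_
  rw [mul_assoc, angleWith, InnerProductGeometry.cos_angle_mul_norm_mul_norm, real_inner_comm,
    ← real_inner_self_eq_norm_mul_norm, ← sub_eq_zero, ← inner_sub_right,
    ← neg_eq_zero, ← inner_neg_right, neg_sub]
  exact K.sub_starProjection_mem_orthogonal v _ (K.starProjection_apply_mem v)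

theorem apply_apply_eq_smul_of_isSymmetric {S : V →ₗ[ℝ] V} (hS : S.IsSymmetric) {c : ℝ}
    (hnorm : ∀ u, ‖S u‖ ^ 2 = c * ‖u‖ ^ 2) (u : V) : S (S u) = c • u := by
  have hzero : S * S - c • LinearMap.id = 0 := by
    refine ((hS.mul_of_commute hS (Commute.refl S)).sub
      (LinearMap.IsSymmetric.id.smul (conj_trivial c))).inner_map_self_eq_zero.1 fun w ↦ ?_
    change inner ℝ (S (S w) - c • w) w = 0
    rw [inner_sub_left, hS, real_inner_smul_left, real_inner_self_eq_norm_sq,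
      real_inner_self_eq_norm_sq, hnorm, sub_self]
  exact sub_eq_zero.1 (LinearMap.congr_fun hzero u)

theorem orthogonal_eq_of_isOrtho_of_sup_eq_top {D D' : Submodule ℝ V} (horth : D ⟂ D')
    (hsup : D ⊔ D' = ⊤) : D'ᗮ = D := by
  rw [← top_inf_eq D'ᗮ, ← hsup, sup_inf_assoc_of_le D' horth, Submodule.inf_orthogonal_eq_bot,
    sup_bot_eq]

variable [CompleteSpace V] [CompleteSpace W] {L A : V →L[ℝ] W} {D : Submodule ℝ V}

theorem starProjection_map_eq_map_adjoint (hL : ∀ u v, inner ℝ (L u) (L v) = inner ℝ u v)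
    [(D.map (L : V →ₗ[ℝ] W)).HasOrthogonalProjection] {w : W}
    (hw : ContinuousLinearMap.adjoint L w ∈ D) :
    (D.map (L : V →ₗ[ℝ] W)).starProjection w = L (ContinuousLinearMap.adjoint L w) := by
  refine Submodule.eq_starProjection_of_mem_of_inner_eq_zero
    (Submodule.mem_map_of_mem (f := (L : V →ₗ[ℝ] W)) hw) ?_
  rintro _ ⟨u, -, rfl⟩
  change inner ℝ (w - L (ContinuousLinearMap.adjoint L w)) (L u) = 0
  rw [inner_sub_left, hL, ContinuousLinearMap.adjoint_inner_left, sub_self]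

theorem adjoint_map_adjoint_map_eq_cos_sq_smul
    (hL : ∀ u v, inner ℝ (L u) (L v) = inner ℝ u v) (hA : ∀ u, ‖A u‖ = ‖u‖)
    (hS : (ContinuousLinearMap.adjoint L ∘L A : V →ₗ[ℝ] V).IsSymmetric)
    (hD : ∀ u ∈ D, ContinuousLinearMap.adjoint L (A u) ∈ D)
    [(D.map (L : V →ₗ[ℝ] W)).HasOrthogonalProjection] {θ : ℝ}
    (hθ : ∀ u ∈ D, u ≠ 0 → angleWith (A u) (D.map (L : V →ₗ[ℝ] W)) = θ) {u : V} (hu : u ∈ D) :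
    ContinuousLinearMap.adjoint L (A (ContinuousLinearMap.adjoint L (A u))) =
      Real.cos θ ^ 2 • u := by
  have hnorm (w : V) (hw : w ∈ D) :
      ‖ContinuousLinearMap.adjoint L (A w)‖ = Real.cos θ * ‖w‖ := by
    rcases eq_or_ne w 0 with rfl | hw0
    · simp
    · rw [← hθ w hw hw0, ← hA w, ← norm_starProjection_eq_cos_angleWith_mul_norm,
        starProjection_map_eq_map_adjoint hL (hD w hw)]
      exact ((LinearMap.norm_map_iff_inner_map_map L).2 hL _).symm
  have h := apply_apply_eq_smul_of_isSymmetric (hS.restrict_invariant hD)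
    (c := Real.cos θ ^ 2) (fun w ↦ ?_) ⟨u, hu⟩
  · exact congrArg Subtype.val h
  · rw [← mul_pow]
    exact congrArg (· ^ 2) (hnorm w w.2)

theorem eq_zero_of_symm_of_skew {α : Type*} {δ : α → α → α → ℝ}
    (hsymm : ∀ x y z, δ x y z = δ y x z) (hskew : ∀ x y z, δ x y z = -δ x z y) (x y z : α) :
    δ x y z = 0 := by
  linarith [hskew x y z, hsymm x z y, hskew z x y, hsymm z y x, hskew y z x, hsymm y x z]

end SlantAlgebra

section OneManifold

variable {E : Type*} [NormedAddCommGroup E] [NormedSpace ℝ E]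
  {M : Type*} [TopologicalSpace M] [ChartedSpace E M] [IsManifold 𝓘(ℝ, E) ∞ M]

theorem IsSmoothField.mdifferentiableAt {X : ∀ x : M, TangentSpace 𝓘(ℝ, E) x}
    (hX : IsSmoothField X) (p : M) : MDiffAt (T% X) p :=
  hX.contMDiffAt.mdifferentiableAt (by simp)

variable [RiemannianBundle (fun x : M ↦ TangentSpace 𝓘(ℝ, E) x)]
  {F : ∀ x : M, TangentSpace 𝓘(ℝ, E) x →L[ℝ] TangentSpace 𝓘(ℝ, E) x}

theorem IsAlmostProductRiemannian.inner_map_left (hF : IsAlmostProductRiemannian F) (x : M)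
    (u v : TangentSpace 𝓘(ℝ, E) x) : inner ℝ (F x u) v = inner ℝ u (F x v) := by
  rw [← hF.inner_map_map x u, hF.sq_eq]

theorem IsAlmostProductRiemannian.mdifferentiableAt (hF : IsAlmostProductRiemannian F) (x : M) :
    MDifferentiableAt 𝓘(ℝ, E) (𝓘(ℝ, E).prod 𝓘(ℝ, E →L[ℝ] E))
      (fun x ↦ TotalSpace.mk' (E →L[ℝ] E)
        (E := fun x : M ↦ TangentSpace 𝓘(ℝ, E) x →L[ℝ] TangentSpace 𝓘(ℝ, E) x) x (F x)) x :=
  hF.smooth.contMDiffAt.mdifferentiableAt (by simp)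

variable [FiniteDimensional ℝ E]
  [IsContMDiffRiemannianBundle 𝓘(ℝ, E) ∞ E (fun x : M ↦ TangentSpace 𝓘(ℝ, E) x)]
  {cov : CovariantDerivative 𝓘(ℝ, E) E (fun x : M ↦ TangentSpace 𝓘(ℝ, E) x)} {p : M}

theorem IsLeviCivita.inner_cov_eq_neg_of_inner_eq_zero (hcov : IsLeviCivita cov)
    {Y Z : ∀ x : M, TangentSpace 𝓘(ℝ, E) x} (hY : MDiffAt (T% Y) p) (hZ : MDiffAt (T% Z) p)
    (hYZ : ∀ x, inner ℝ (Y x) (Z x) = 0) (v : TangentSpace 𝓘(ℝ, E) p) :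
    inner ℝ (cov Y p v) (Z p) = -inner ℝ (Y p) (cov Z p v) := by
  have hder := hcov.mvfderiv_inner hY hZ v
  rw [funext hYZ, mvfderiv_const] at hder
  exact eq_neg_of_add_eq_zero_left hder.symm

end OneManifold

section Submanifold

variable {E : Type*} [NormedAddCommGroup E] [NormedSpace ℝ E] [FiniteDimensional ℝ E]
  {M : Type*} [TopologicalSpace M] [ChartedSpace E M]
  [RiemannianBundle (fun x : M ↦ TangentSpace 𝓘(ℝ, E) x)]
  {E' : Type*} [NormedAddCommGroup E'] [NormedSpace ℝ E'] [FiniteDimensional ℝ E']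
  {N : Type*} [TopologicalSpace N] [ChartedSpace E' N]
  [RiemannianBundle (fun y : N ↦ TangentSpace 𝓘(ℝ, E') y)]
  {F : ∀ y : N, TangentSpace 𝓘(ℝ, E') y →L[ℝ] TangentSpace 𝓘(ℝ, E') y}
  {f : M → N} {p : M}

section Decomposition

theorem inner_tangentPart_left (x : M) (w : TangentSpace 𝓘(ℝ, E') (f x))
    (u : TangentSpace 𝓘(ℝ, E) x) :
    inner ℝ (tangentPart f x w) u = inner ℝ w (mfderiv% f x u) :=
  ContinuousLinearMap.adjoint_inner_left _ _ _

theorem tangentPart_sub (x : M) (w w' : TangentSpace 𝓘(ℝ, E') (f x)) :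
    tangentPart (E := E) f x (w - w') = tangentPart f x w - tangentPart f x w' :=
  map_sub _ w w'

theorem normalPart_sub (x : M) (w w' : TangentSpace 𝓘(ℝ, E') (f x)) :
    normalPart (E := E) f x (w - w') = normalPart (E := E) f x w - normalPart (E := E) f x w' := by
  simp only [normalPart, tangentPart_sub, map_sub]
  abel

theorem IsIsometricImmersion.tangentPart_mfderiv (hf : IsIsometricImmersion (E := E) (E' := E') f)
    (x : M) (u : TangentSpace 𝓘(ℝ, E) x) : tangentPart f x (mfderiv% f x u) = u :=
  ext_inner_right ℝ fun w ↦ by rw [inner_tangentPart_left, hf.inner_mfderiv]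

variable [IsManifold 𝓘(ℝ, E) ∞ M]
  [IsContMDiffRiemannianBundle 𝓘(ℝ, E) ∞ E (fun x : M ↦ TangentSpace 𝓘(ℝ, E) x)]
  [IsManifold 𝓘(ℝ, E') ∞ N]
  [IsContMDiffRiemannianBundle 𝓘(ℝ, E') ∞ E' (fun y : N ↦ TangentSpace 𝓘(ℝ, E') y)]

theorem IsIsometricImmersion.inner_map_mfderiv_right
    (hf : IsIsometricImmersion (E := E) (E' := E') f) (x : M)
    (w : TangentSpace 𝓘(ℝ, E') (f x)) (u : TangentSpace 𝓘(ℝ, E) x) :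
    inner ℝ w (F (f x) (mfderiv% f x u)) =
      inner ℝ (tangentPart f x w) (tanF F f x u) +
        inner ℝ (normalPart (E := E) f x w) (norF F f x u) := by
  have hmap : F (f x) (mfderiv% f x u) = mfderiv% f x (tanF F f x u) + norF F f x u := by
    simp [norF, normalPart, tanF]
  have hw : w = mfderiv% f x (tangentPart f x w) + normalPart (E := E) f x w := by
    simp [normalPart]
  have hort : inner ℝ (mfderiv% f x (tangentPart f x w)) (norF F f x u) = 0 := by
    rw [real_inner_comm]
    exact inner_normalPart_mfderiv hf x _ _
  rw [hmap, inner_add_right, inner_tangentPart_left]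
  conv_lhs => enter [2]; rw [hw, inner_add_left, hort, zero_add]

end Decomposition

section Gauss

variable [IsManifold 𝓘(ℝ, E) ∞ M]
  [IsManifold 𝓘(ℝ, E') ∞ N]
  {covN : CovariantDerivative 𝓘(ℝ, E') E' (fun y : N ↦ TangentSpace 𝓘(ℝ, E') y)}
  {X Y : ∀ x : M, TangentSpace 𝓘(ℝ, E) x}

theorem secondFundamentalForm_comm (htor : covN.torsion = 0)
    (hf : IsIsometricImmersion (E := E) (E' := E') f)
    (hX : MDiffAt (T% X) p) (hY : MDiffAt (T% Y) p) :
    secondFundamentalForm covN f X Y p = secondFundamentalForm covN f Y X p := by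
  have hsub := covAlong_mfderiv_sub covN htor (hf.contMDiff.contMDiffAt.of_le (by norm_cast)) hX hY
  rw [← sub_eq_zero, secondFundamentalForm, secondFundamentalForm, ← normalPart_sub, hsub,
    normalPart, hf.tangentPart_mfderiv, sub_self]

variable [IsContMDiffRiemannianBundle 𝓘(ℝ, E) ∞ E (fun x : M ↦ TangentSpace 𝓘(ℝ, E) x)]
  [IsContMDiffRiemannianBundle 𝓘(ℝ, E') ∞ E' (fun y : N ↦ TangentSpace 𝓘(ℝ, E') y)]

theorem IsIsometricImmersion.tangentPart_covAlong_mfderiv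
    (hf : IsIsometricImmersion (E := E) (E' := E') f) (hcovN : IsLeviCivita covN)
    {cov : CovariantDerivative 𝓘(ℝ, E) E (fun x : M ↦ TangentSpace 𝓘(ℝ, E) x)}
    (hcov : IsLeviCivita cov) (hY : MDiffAt (T% Y) p) (v : TangentSpace 𝓘(ℝ, E) p) :
    tangentPart f p (covAlong covN f (fun q ↦ mfderiv% f q (Y q)) p v) = cov Y p v := by
  have hfp : CMDiffAt 2 f p := hf.contMDiff.contMDiffAt.of_le (by norm_cast)
  let δ (X Y Z : {X : ∀ x : M, TangentSpace 𝓘(ℝ, E) x // MDiffAt (T% X) p}) : ℝ :=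
    inner ℝ (tangentPart f p (covAlong covN f (fun q ↦ mfderiv% f q (Y.1 q)) p (X.1 p)) -
      cov Y.1 p (X.1 p)) (Z.1 p)
  have hsymm (X Y Z) : δ X Y Z = δ Y X Z := by
    have hN := covAlong_mfderiv_sub covN hcovN.torsion_eq_zero hfp X.2 Y.2
    have hM := cov.torsion_eq_zero_iff.1 hcov.torsion_eq_zero X.2 Y.2
    have htan := congrArg (tangentPart (E := E) f p) hN
    rw [tangentPart_sub, hf.tangentPart_mfderiv, ← hM, sub_eq_sub_iff_sub_eq_sub] at htan
    exact congrArg (inner ℝ · (Z.1 p)) htan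
  have hskew (X Y Z) : δ X Y Z = -δ X Z Y := by
    have hN := hcovN.mvfderiv_inner_along (hfp.mdifferentiableAt (by simp))
      (differentiableAlongAt_mfderiv hfp Y.2) (differentiableAlongAt_mfderiv hfp Z.2) (X.1 p)
    have hM := hcov.mvfderiv_inner Y.2 Z.2 (X.1 p)
    simp only [hf.inner_mfderiv] at hN
    simp only [δ, inner_sub_left, inner_tangentPart_left]
    rw [real_inner_comm _ (cov Z.1 p (X.1 p)), real_inner_comm (mfderiv% f p (Y.1 p))]
    linarith
  obtain ⟨X, hX, rfl⟩ : ∃ X : ∀ x : M, TangentSpace 𝓘(ℝ, E) x, MDiffAt (T% X) p ∧ X p = v :=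
    ⟨_, FiberBundle.mdifferentiableAt_extend 𝓘(ℝ, E) E v, by simp⟩
  refine sub_eq_zero.1 (ext_inner_right ℝ fun w ↦ ?_)
  obtain ⟨Z, hZ, rfl⟩ : ∃ Z : ∀ x : M, TangentSpace 𝓘(ℝ, E) x, MDiffAt (T% Z) p ∧ Z p = w :=
    ⟨_, FiberBundle.mdifferentiableAt_extend 𝓘(ℝ, E) E w, by simp⟩
  rw [inner_zero_left]
  exact eq_zero_of_symm_of_skew hsymm hskew ⟨X, hX⟩ ⟨Y, hY⟩ ⟨Z, hZ⟩

theorem mdifferentiableAt_tanF (hf : CMDiffAt 2 f p)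
    (hF : MDifferentiableAt 𝓘(ℝ, E') (𝓘(ℝ, E').prod 𝓘(ℝ, E' →L[ℝ] E'))
      (fun y ↦ TotalSpace.mk' (E' →L[ℝ] E')
        (E := fun y : N ↦ TangentSpace 𝓘(ℝ, E') y →L[ℝ] TangentSpace 𝓘(ℝ, E') y) y (F y)) (f p))
    {Y : ∀ x : M, TangentSpace 𝓘(ℝ, E) x} (hY : MDiffAt (T% Y) p) :
    MDiffAt (T% (fun x ↦ tanF F f x (Y x))) p := by
  have hfp : MDiffAt f p := hf.mdifferentiableAt (by simp)
  refine mdifferentiableAt_of_inner_coordFrame fun i ↦ ?_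
  have hcomm (x : M) : inner ℝ (coordFrame p i x) (tanF F f x (Y x)) =
      inner ℝ (F (f x) (mfderiv% f x (Y x))) (mfderiv% f x (coordFrame p i x)) := by
    rw [real_inner_comm, tanF, inner_tangentPart_left]
  simp only [hcomm]
  exact mdifferentiableAt_inner_along hfp ((differentiableAlongAt_mfderiv hf hY).map hfp hF)
    (differentiableAlongAt_mfderiv hf (mdifferentiableAt_coordFrame p i))

/-- Both sides of `g(F Y, Z) = g(T Y, Z)` are differentiated: the left one in `N`, where `F` is
parallel, the right one in `M`. -/
theorem IsLocallyProductRiemannian.inner_cov_tanF_sub (hN : IsLocallyProductRiemannian covN F)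
    (hf : IsIsometricImmersion (E := E) (E' := E') f)
    {cov : CovariantDerivative 𝓘(ℝ, E) E (fun x : M ↦ TangentSpace 𝓘(ℝ, E) x)}
    (hcov : IsLeviCivita cov) {Y Z : ∀ x : M, TangentSpace 𝓘(ℝ, E) x}
    (hY : MDiffAt (T% Y) p) (hZ : MDiffAt (T% Z) p) (X : ∀ x : M, TangentSpace 𝓘(ℝ, E) x) :
    inner ℝ (cov (fun x ↦ tanF F f x (Y x)) p (X p)) (Z p) -
        inner ℝ (cov Y p (X p)) (tanF F f p (Z p)) =
      inner ℝ (secondFundamentalForm covN f X Z p) (norF F f p (Y p)) +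
        inner ℝ (secondFundamentalForm covN f X Y p) (norF F f p (Z p)) := by
  have hf2 : CMDiffAt 2 f p := hf.contMDiff.contMDiffAt.of_le (by norm_cast)
  have hfp : MDiffAt f p := hf2.mdifferentiableAt (by simp)
  have hdfY := differentiableAlongAt_mfderiv hf2 hY
  have hFp := hN.mdifferentiableAt (f p)
  have hderN := hN.isLeviCivita.mvfderiv_inner_along hfp (hdfY.map hfp hFp)
    (differentiableAlongAt_mfderiv hf2 hZ) (X p)
  have hderM := hcov.mvfderiv_inner (mdifferentiableAt_tanF hf2 hFp hY) hZ (X p)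
  rw [covAlong_map covN hfp hFp hdfY fun Y hY w ↦ sub_eq_zero.1 (hN.parallel Y _ hY w),
    hN.inner_map_left, real_inner_comm (covAlong covN f _ p (X p)),
    hf.inner_map_mfderiv_right, hf.inner_map_mfderiv_right,
    hf.tangentPart_covAlong_mfderiv hN.isLeviCivita hcov hY,
    hf.tangentPart_covAlong_mfderiv hN.isLeviCivita hcov hZ] at hderN
  have hfun : (fun q ↦ inner ℝ (F (f q) (mfderiv% f q (Y q))) (mfderiv% f q (Z q))) =
      fun q ↦ inner ℝ (tanF F f q (Y q)) (Z q) :=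
    funext fun q ↦ (inner_tangentPart_left q _ _).symm
  rw [hfun, hderM, real_inner_comm (cov Z p (X p))] at hderN
  simp only [secondFundamentalForm]
  linarith

end Gauss

variable {D₁ D₂ : ∀ x : M, Submodule ℝ (TangentSpace 𝓘(ℝ, E) x)} {θ₁ θ₂ : M → ℝ}
  [IsManifold 𝓘(ℝ, E) ∞ M]

namespace IsPointwiseBiSlant

omit [FiniteDimensional ℝ E'] in
theorem symm (h : IsPointwiseBiSlant F f D₁ D₂ θ₁ θ₂) :
    IsPointwiseBiSlant F f D₂ D₁ θ₂ θ₁ where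
  isometric := h.isometric
  smooth₁ := h.smooth₂
  smooth₂ := h.smooth₁
  orthogonal x := (h.orthogonal x).symm
  sup_eq_top x := by rw [sup_comm, h.sup_eq_top]
  map₁ := h.map₂
  map₂ := h.map₁
  slant₁ := h.slant₂
  slant₂ := h.slant₁

variable (h : IsPointwiseBiSlant F f D₁ D₂ θ₁ θ₂) {x : M} {u : TangentSpace 𝓘(ℝ, E) x}
include h

theorem tanF_mem (hu : u ∈ D₁ x) : tanF F f x u ∈ D₁ x := by
  rw [← orthogonal_eq_of_isOrtho_of_sup_eq_top (h.orthogonal x) (h.sup_eq_top x),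
    Submodule.mem_orthogonal']
  intro w hw
  rw [tanF, inner_tangentPart_left]
  exact h.map₁ x u hu w hw

theorem projTanF_eq (hu : u ∈ D₁ x) : projTanF F f D₁ x u = tanF F f x u :=
  Submodule.starProjection_eq_self_iff.2 (h.tanF_mem hu)

variable [IsManifold 𝓘(ℝ, E') ∞ N]

theorem tanF_tanF (hF : IsAlmostProductRiemannian F) (hu : u ∈ D₁ x) :
    tanF F f x (tanF F f x u) = Real.cos (θ₁ x) ^ 2 • u := by
  refine adjoint_map_adjoint_map_eq_cos_sq_smul (A := F (f x) ∘L mfderiv% f x)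
    (h.isometric.inner_mfderiv x)
    ((LinearMap.norm_map_iff_inner_map_map _).2 fun u v ↦ ?_) (fun u v ↦ ?_)
    (fun _ hu ↦ h.tanF_mem hu) (h.slant₁ x) hu
  · exact (hF.inner_map_map _ _ _).trans (h.isometric.inner_mfderiv x u v)
  · change inner ℝ (tanF F f x u) v = inner ℝ u (tanF F f x v)
    rw [tanF, inner_tangentPart_left, hF.inner_map_left, real_inner_comm, ← inner_tangentPart_left,
      real_inner_comm, tanF]

variable [IsContMDiffRiemannianBundle 𝓘(ℝ, E) ∞ E (fun x : M ↦ TangentSpace 𝓘(ℝ, E) x)]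
  [IsContMDiffRiemannianBundle 𝓘(ℝ, E') ∞ E' (fun y : N ↦ TangentSpace 𝓘(ℝ, E') y)]

theorem inner_cov_tanF_tanF (hN : IsAlmostProductRiemannian F)
    {cov : CovariantDerivative 𝓘(ℝ, E) E (fun x : M ↦ TangentSpace 𝓘(ℝ, E) x)}
    (hcov : IsLeviCivita cov) {Y Z : ∀ x : M, TangentSpace 𝓘(ℝ, E) x}
    (hY : MDiffAt (T% Y) p) (hZ : MDiffAt (T% Z) p)
    (hYD : ∀ x, Y x ∈ D₁ x) (hZD : ∀ x, Z x ∈ D₂ x) (v : TangentSpace 𝓘(ℝ, E) p) :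
    inner ℝ (cov (fun x ↦ tanF F f x (tanF F f x (Y x))) p v) (Z p) =
      Real.cos (θ₁ p) ^ 2 * inner ℝ (cov Y p v) (Z p) := by
  have hf : CMDiffAt 2 f p := h.isometric.contMDiff.contMDiffAt.of_le (by norm_cast)
  have hort {U : ∀ x : M, TangentSpace 𝓘(ℝ, E) x} (hUD : ∀ x, U x ∈ D₁ x) (x : M) :
      inner ℝ (U x) (Z x) = 0 :=
    Submodule.isOrtho_iff_inner_eq.1 (h.orthogonal x) _ (hUD x) _ (hZD x)
  have hTTY := mdifferentiableAt_tanF hf (hN.mdifferentiableAt (f p))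
    (mdifferentiableAt_tanF hf (hN.mdifferentiableAt (f p)) hY)
  rw [hcov.inner_cov_eq_neg_of_inner_eq_zero hTTY hZ
      (hort fun x ↦ h.tanF_mem (h.tanF_mem (hYD x))),
    hcov.inner_cov_eq_neg_of_inner_eq_zero hY hZ (hort hYD), h.tanF_tanF hN (hYD p),
    real_inner_smul_left, mul_neg]

end IsPointwiseBiSlant

end Submanifold

end

end BiSlant

theorem lemma3p2_general
    {E : Type*} [NormedAddCommGroup E] [NormedSpace ℝ E] [FiniteDimensional ℝ E]
    {M : Type*} [TopologicalSpace M] [ChartedSpace E M] [IsManifold 𝓘(ℝ, E) ∞ M]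
    [RiemannianBundle (fun x : M ↦ TangentSpace 𝓘(ℝ, E) x)]
    [IsContMDiffRiemannianBundle 𝓘(ℝ, E) ∞ E (fun x : M ↦ TangentSpace 𝓘(ℝ, E) x)]
    {E' : Type*} [NormedAddCommGroup E'] [NormedSpace ℝ E'] [FiniteDimensional ℝ E']
    {N : Type*} [TopologicalSpace N] [ChartedSpace E' N] [IsManifold 𝓘(ℝ, E') ∞ N]
    [RiemannianBundle (fun y : N ↦ TangentSpace 𝓘(ℝ, E') y)]
    [IsContMDiffRiemannianBundle 𝓘(ℝ, E') ∞ E' (fun y : N ↦ TangentSpace 𝓘(ℝ, E') y)]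
    {covN : CovariantDerivative 𝓘(ℝ, E') E' (fun y : N ↦ TangentSpace 𝓘(ℝ, E') y)}
    {F : ∀ y : N, TangentSpace 𝓘(ℝ, E') y →L[ℝ] TangentSpace 𝓘(ℝ, E') y}
    (hN : BiSlant.IsLocallyProductRiemannian covN F)
    {f : M → N} {D₁ D₂ : ∀ x : M, Submodule ℝ (TangentSpace 𝓘(ℝ, E) x)} {θ₁ θ₂ : M → ℝ}
    (hM : BiSlant.IsPointwiseBiSlant F f D₁ D₂ θ₁ θ₂)
    {cov : CovariantDerivative 𝓘(ℝ, E) E (fun x : M ↦ TangentSpace 𝓘(ℝ, E) x)}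
    (hcov : BiSlant.IsLeviCivita cov) {Y Z : ∀ x : M, TangentSpace 𝓘(ℝ, E) x} {p : M}
    (hY : MDiffAt (T% Y) p) (hZ : MDiffAt (T% Z) p)
    (hYD : ∀ x, Y x ∈ D₁ x) (hZD : ∀ x, Z x ∈ D₂ x) (X : ∀ x : M, TangentSpace 𝓘(ℝ, E) x) :
    let σ := BiSlant.secondFundamentalForm (E := E) covN f
    let om := BiSlant.norF (E := E) F f
    let T₁ := BiSlant.projTanF F f D₁
    let T₂ := BiSlant.projTanF F f D₂
    (Real.sin (θ₂ p) ^ 2 - Real.sin (θ₁ p) ^ 2) * inner ℝ (cov Y p (X p)) (Z p) =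
      (inner ℝ (σ X Z p) (om p (T₁ p (Y p))) +
        inner ℝ (σ X (fun x ↦ T₂ x (Z x)) p) (om p (Y p))) +
      (inner ℝ (σ X Y p) (om p (T₂ p (Z p))) +
        inner ℝ (σ X (fun x ↦ T₁ x (Y x)) p) (om p (Z p))) := by
  intro σ om T₁ T₂
  have hT₁ (x : M) : T₁ x (Y x) = BiSlant.tanF F f x (Y x) := hM.projTanF_eq (hYD x)
  have hT₂ (x : M) : T₂ x (Z x) = BiSlant.tanF F f x (Z x) := hM.symm.projTanF_eq (hZD x)
  have hf : CMDiffAt 2 f p := hM.isometric.contMDiff.contMDiffAt.of_le (by norm_cast)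
  have hF := hN.mdifferentiableAt (f p)
  have hTY := BiSlant.mdifferentiableAt_tanF hf hF hY
  have hTZ := BiSlant.mdifferentiableAt_tanF hf hF hZ
  have hTY_Z := hN.inner_cov_tanF_sub hM.isometric hcov hTY hZ X
  have hY_TZ := hN.inner_cov_tanF_sub hM.isometric hcov hY hTZ X
  rw [hM.inner_cov_tanF_tanF hN.toIsAlmostProductRiemannian hcov hY hZ hYD hZD, Real.cos_sq']
    at hTY_Z
  rw [hM.symm.tanF_tanF hN.toIsAlmostProductRiemannian (hZD p), real_inner_smul_right,
    Real.cos_sq'] at hY_TZ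
  simp only [hT₁, hT₂]
  linarith

theorem lemma3p2
    {E : Type*} [NormedAddCommGroup E] [NormedSpace ℝ E] [FiniteDimensional ℝ E]
    {M : Type*} [TopologicalSpace M] [T2Space M] [SecondCountableTopology M]
    [ChartedSpace E M] [IsManifold 𝓘(ℝ, E) ∞ M]
    [RiemannianBundle (fun x : M ↦ TangentSpace 𝓘(ℝ, E) x)]
    [IsContMDiffRiemannianBundle 𝓘(ℝ, E) ∞ E (fun x : M ↦ TangentSpace 𝓘(ℝ, E) x)]
    {E' : Type*} [NormedAddCommGroup E'] [NormedSpace ℝ E'] [FiniteDimensional ℝ E']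
    {N : Type*} [TopologicalSpace N] [T2Space N] [SecondCountableTopology N]
    [ChartedSpace E' N] [IsManifold 𝓘(ℝ, E') ∞ N]
    [RiemannianBundle (fun y : N ↦ TangentSpace 𝓘(ℝ, E') y)]
    [IsContMDiffRiemannianBundle 𝓘(ℝ, E') ∞ E' (fun y : N ↦ TangentSpace 𝓘(ℝ, E') y)]
    -- the ambient locally product Riemannian manifold
    (covN : CovariantDerivative 𝓘(ℝ, E') E' (fun y : N ↦ TangentSpace 𝓘(ℝ, E') y))
    (F : ∀ y : N, TangentSpace 𝓘(ℝ, E') y →L[ℝ] TangentSpace 𝓘(ℝ, E') y)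
    (hN : BiSlant.IsLocallyProductRiemannian covN F)
    -- the pointwise bi-slant submanifold and its Levi-Civita connection
    (f : M → N) (D₁ D₂ : ∀ x : M, Submodule ℝ (TangentSpace 𝓘(ℝ, E) x)) (θ₁ θ₂ : M → ℝ)
    (hM : BiSlant.IsPointwiseBiSlant F f D₁ D₂ θ₁ θ₂) (hθ : θ₁ ≠ θ₂)
    (cov : CovariantDerivative 𝓘(ℝ, E) E (fun x : M ↦ TangentSpace 𝓘(ℝ, E) x))
    (hcov : BiSlant.IsLeviCivita cov) :
    let σ := BiSlant.secondFundamentalForm (E := E) covN f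
    let om := BiSlant.norF (E := E) F f
    let T₁ := BiSlant.projTanF F f D₁
    let T₂ := BiSlant.projTanF F f D₂
    (∀ X Y Z : ∀ x : M, TangentSpace 𝓘(ℝ, E) x,
      BiSlant.IsSmoothField X → BiSlant.IsSmoothField Y → BiSlant.IsSmoothField Z →
      (∀ x, X x ∈ D₁ x) → (∀ x, Y x ∈ D₁ x) → (∀ x, Z x ∈ D₂ x) →
      ∀ p : M,
        (Real.sin (θ₂ p) ^ 2 - Real.sin (θ₁ p) ^ 2) * inner ℝ (cov Y p (X p)) (Z p) =
          (inner ℝ (σ X Z p) (om p (T₁ p (Y p))) +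
            inner ℝ (σ X (fun x ↦ T₂ x (Z x)) p) (om p (Y p))) +
          (inner ℝ (σ X Y p) (om p (T₂ p (Z p))) +
            inner ℝ (σ X (fun x ↦ T₁ x (Y x)) p) (om p (Z p)))) ∧
    (∀ Z W X : ∀ x : M, TangentSpace 𝓘(ℝ, E) x,
      BiSlant.IsSmoothField Z → BiSlant.IsSmoothField W → BiSlant.IsSmoothField X →
      (∀ x, Z x ∈ D₂ x) → (∀ x, W x ∈ D₂ x) → (∀ x, X x ∈ D₁ x) →
      ∀ p : M,
        (Real.sin (θ₁ p) ^ 2 - Real.sin (θ₂ p) ^ 2) * inner ℝ (cov W p (Z p)) (X p) =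
          (inner ℝ (σ X Z p) (om p (T₂ p (W p))) +
            inner ℝ (σ Z (fun x ↦ T₁ x (X x)) p) (om p (W p))) +
          (inner ℝ (σ Z W p) (om p (T₁ p (X p))) +
            inner ℝ (σ Z (fun x ↦ T₂ x (W x)) p) (om p (X p)))) := by
  intro σ om T₁ T₂
  refine ⟨fun X Y Z _ hY hZ _ hYD hZD p ↦ lemma3p2_general hN hM hcov (hY.mdifferentiableAt p)
    (hZ.mdifferentiableAt p) hYD hZD X, fun Z W X hZ hW hX _ hWD hXD p ↦ ?_⟩
  have hcomm : σ X Z p = σ Z X p :=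
    BiSlant.secondFundamentalForm_comm hN.isLeviCivita.torsion_eq_zero hM.isometric
      (hX.mdifferentiableAt p) (hZ.mdifferentiableAt p)
  rw [hcomm]
  exact lemma3p2_general hN hM.symm hcov (hW.mdifferentiableAt p) (hX.mdifferentiableAt p) hWD hXD Z
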